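/- Notation. For integers $1\le k<d$ let $R_{k,d}$ be the set of integer pairs $(k',d'')$ with $1\le k'\le k$, $2\le d''\le d$ and $\frac kd<\frac{k'}{d''}<1$, and let $S_{k,d}$ be the set of all sequences of pairs of positive integers $((k_0,d_0),\dots,(k_u,d_u))$, $u\ge 0$, with $(k_0,d_0)=(k,d)$, $k_j<d_j$ for all $j$, $k_0\ge\dots\ge k_u\ge1$, $d_0>\dots>d_u\ge2$ and $\frac{k_0}{d_0}<\dots<\frac{k_u}{d_u}<1$. For $\varepsilon>0$, positive integers $s$, and a family $q=(q_{k',d''})$ of nonnegative integers put $$B_{s,k,d,\varepsilon}(m,n,q)=\sum_{((k_0,d_0),\dots,(k_u,d_u))\in S_{k,d}} m^{\frac{sk_u}{sd_u-d_u+k_u}+\varepsilon}\Bigl(n^{\frac d{d-k}}\prod_{j=1}^u q_{k_j,d_j}^{\frac{d_j}{d_j-k_j}-\frac{d_{j-1}}{d_{j-1}-k_{j-1}}}\Bigr)^{\frac{(d_u-k_u)(s-1)}{sd_u-d_u+k_u}}+m+n .$$ A $k$-flat is a $k$-dimensional affine subspace of $\mathbb R^d$. A variety of degree at most $c$ in $\mathbb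 R^d$ is the common zero set of finitely many real polynomials of degree at most $c$; its dimension is the Krull dimension of its ring of polynomial functions. For a finite set $\mathcal P$ of points and a finite set $\mathcal V$ of flats, $I(\mathcal P,\mathcal V)$ is the number of pairs $(p,v)\in\mathcal P\times\mathcal V$ with $p\in v$; the incidence graph contains no $K_{s,t}$ if no $s$ distinct points of $\mathcal P$ all lie in $t$ common distinct members of $\mathcal V$. (The general incidence bound asserts that for all $s\geq 2,t,\varepsilon$ there are constants $c,C$ such that $I(\mathcal P,\mathcal V)\le C\,B_{s,k,d,\varepsilon}(m,n,q)$ for every set $\mathcal P$ of $m$ points and every set $\mathcal V$ of $n$ $k$-flats in $\mathbb R^d$ such that the incidence graph contains no $K_{s,t}$ and, for each $(k',d'')\in R_{k,d}$, every $d''$-dimensional variety of degree at most $c$ has a $k'$-dimensional intersection with at most $q_{k',d''}$ members of $\mathcal V$.) Theorem. Let $k,d,d'$ be positive integers with $\frac{d'-1}{d'}>\frac kd$ and $d'-1\le k$ (that is, $(d'-1,d')\in R_{k,d}$). Then for $s=2$ the dependence on $q_{d'-1,d'}$ cannot be removed from the bound $B_{2,k,d,\varepsilon}$ for $k$-flats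 in $\mathbb R^d$. Precisely: there exist a positive integer $t$ and $\varepsilon_0>0$ such that for all $0<\varepsilon\le\varepsilon_0$ and all constants $c\in\mathbb N$, $C\in\mathbb R$ there are a finite set $\mathcal P$ of $m$ points and a finite set $\mathcal V$ of $n$ $k$-flats in $\mathbb R^d$, a family $q$ of nonnegative integers and a $d'$-flat $F$ such that (i) the incidence graph of $\mathcal P\times\mathcal V$ contains no $K_{2,t}$; (ii) for each $(k',d'')\in R_{k,d}$, every $d''$-dimensional variety of degree at most $c$ has a $k'$-dimensional intersection with at most $q_{k',d''}$ members of $\mathcal V$; (iii) $\mathcal P\subset F$, and every member of $\mathcal V$ meets $F$ in a $(d'-1)$-flat; (iv) $I(\mathcal P,\mathcal V)>C\cdot B_{2,k,d,\varepsilon}(m,n,\tilde q)$, where $\tilde q$ is obtained from $q$ by setting $q_{d'-1,d'}$ equal to $1$ and changing nothing else. -/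

import Mathlib

noncomputable section

namespace FlatIncidence

/-- The set `R_{k,d}` of pairs `(k', d')` with `1 ≤ k' ≤ k`, `2 ≤ d' ≤ d`, `k/d < k'/d' < 1`. -/
def ratioPairs (k d : ℕ) : Set (ℕ × ℕ) :=
  {p | 1 ≤ p.1 ∧ p.1 ≤ k ∧ 2 ≤ p.2 ∧ p.2 ≤ d ∧
    (k : ℚ) / d < (p.1 : ℚ) / p.2 ∧ (p.1 : ℚ) / p.2 < 1}

/-- Significant sequences `((k₀,d₀), …, (k_u,d_u))`. All relations imposed on consecutive pairs are
transitive, so they are imposed on every two members. -/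
def IsSignificant (σ : List (ℕ × ℕ)) : Prop :=
  (∀ p ∈ σ, 1 ≤ p.1 ∧ 2 ≤ p.2 ∧ p.1 < p.2) ∧
  σ.Pairwise fun p q => q.1 ≤ p.1 ∧ q.2 < p.2 ∧ (p.1 : ℚ) / p.2 < (q.1 : ℚ) / q.2

/-- The set `S_{k,d}` of significant sequences starting with `(k,d)`. A sequence
`((k,d), (k₁,d₁), …, (k_u,d_u))` is recorded by its tail `((k₁,d₁), …, (k_u,d_u))`. -/
def significantTails (k d : ℕ) : Set (List (ℕ × ℕ)) :=
  {τ | IsSignificant ((k, d) :: τ)}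

theorem significantTails_finite (k d : ℕ) : (significantTails k d).Finite := by
  refine Set.Finite.of_finite_image (f := fun τ : List (ℕ × ℕ) => τ.toFinset)
    (((Finset.range (k + 1) ×ˢ Finset.range (d + 1)).powerset.finite_toSet).subset ?_) ?_
  · rintro _ ⟨τ, hτ, rfl⟩
    have h := (List.pairwise_cons.mp hτ.2).1
    simp only [Finset.coe_powerset, Set.mem_preimage, Set.mem_powerset_iff]
    intro p hp
    have hp' := h p (by simpa using hp)
    simp only [Finset.coe_product, Finset.coe_range, Set.mem_prod, Set.mem_Iio]
    simp only at hp'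
    omega
  · intro τ hτ τ' hτ' he
    have h₁ : τ.Pairwise fun p q => q.2 < p.2 :=
      (List.pairwise_cons.mp hτ.2).2.imp fun h => h.2.1
    have h₂ : τ'.Pairwise fun p q => q.2 < p.2 :=
      (List.pairwise_cons.mp hτ'.2).2.imp fun h => h.2.1
    have n₁ : τ.Nodup := h₁.imp fun h e => by simp [e] at h
    have n₂ : τ'.Nodup := h₂.imp fun h e => by simp [e] at h
    have hp : τ.Perm τ' := by
      have h := List.toFinset_eq_iff_perm_dedup.mp he
      rwa [n₁.dedup, n₂.dedup] at h
    exact hp.eq_of_pairwise (fun a b _ _ h h' => absurd h (by omega)) h₁ h₂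

/-- `d / (d - k)` for the pair `(k,d)`. -/
def codimWeight (p : ℕ × ℕ) : ℝ := (p.2 : ℝ) / ((p.2 : ℝ) - p.1)

/-- The term of the incidence bound that belongs to the sequence `(k,d) :: τ = ((k,d), …, (k_u,d_u))`,
`m ^ (s k_u / (s d_u - d_u + k_u) + ε) * (n ^ (d/(d-k)) *
  ∏_{j=1}^u q_{k_j,d_j} ^ (d_j/(d_j-k_j) - d_{j-1}/(d_{j-1}-k_{j-1})))
    ^ ((d_u-k_u)(s-1) / (s d_u - d_u + k_u))`. -/
def boundTerm (s k d : ℕ) (ε : ℝ) (m n : ℕ) (q : ℕ × ℕ → ℕ) (τ : List (ℕ × ℕ)) : ℝ :=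
  let l : ℕ × ℕ := τ.getLastD (k, d)
  let ku : ℝ := l.1
  let du : ℝ := l.2
  (m : ℝ) ^ (s * ku / (s * du - du + ku) + ε) *
    ((n : ℝ) ^ codimWeight (k, d) *
      ((((k, d) :: τ).zip τ).map fun e =>
        (q e.2 : ℝ) ^ (codimWeight e.2 - codimWeight e.1)).prod) ^
      ((du - ku) * (s - 1) / (s * du - du + ku))

/-- The incidence bound: the sum of the terms over `S_{k,d}`, plus `m + n`. -/
def incidenceBound (s k d : ℕ) (ε : ℝ) (m n : ℕ) (q : ℕ × ℕ → ℕ) : ℝ :=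
  (∑ τ ∈ (significantTails_finite k d).toFinset, boundTerm s k d ε m n q τ) + m + n

/-- `U ⊆ ℝ^d` is a real variety of degree at most `c`: the common zero set of finitely many real
polynomials of degree at most `c`. -/
def IsVarietyOfDegreeLE {d : ℕ} (c : ℕ) (U : Set (Fin d → ℝ)) : Prop :=
  ∃ F : Finset (MvPolynomial (Fin d) ℝ),
    (∀ f ∈ F, f.totalDegree ≤ c) ∧ U = {x | ∀ f ∈ F, MvPolynomial.eval x f = 0}

/-- The dimension of a real algebraic set: the Krull dimension of its ring of polynomial
functions. -/
def algDim {d : ℕ} (U : Set (Fin d → ℝ)) : WithBot ℕ∞ :=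
  ringKrullDim (MvPolynomial (Fin d) ℝ ⧸ MvPolynomial.vanishingIdeal ℝ U)

/-- A `k`-flat: a nonempty affine subspace of dimension `k`. -/
def IsFlat {d : ℕ} (k : ℕ) (v : AffineSubspace ℝ (Fin d → ℝ)) : Prop :=
  (v : Set (Fin d → ℝ)).Nonempty ∧ Module.finrank ℝ v.direction = k

/-- The number `I(P, V)` of incidences. -/
def incidences {d : ℕ} (P : Finset (Fin d → ℝ))
    (V : Finset (AffineSubspace ℝ (Fin d → ℝ))) : ℕ :=
  {e : (Fin d → ℝ) × AffineSubspace ℝ (Fin d → ℝ) |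
    e.1 ∈ P ∧ e.2 ∈ V ∧ e.1 ∈ e.2}.ncard

/-- The incidence graph of `P × V` contains no `K_{s,t}` (`s` points, `t` flats). -/
def NoBiclique {d : ℕ} (s t : ℕ) (P : Finset (Fin d → ℝ))
    (V : Finset (AffineSubspace ℝ (Fin d → ℝ))) : Prop :=
  ∀ A ⊆ P, ∀ B ⊆ V, A.card = s → B.card = t → ∃ p ∈ A, ∃ v ∈ B, p ∉ v

/-- For each `(k',d') ∈ R_{k,d}`, every `d'`-dimensional variety of degree at most `c` has a
`k'`-dimensional intersection with at most `q_{k',d'}` members of `V`. -/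
def IntersectionCondition {d : ℕ} (k c : ℕ) (q : ℕ × ℕ → ℕ)
    (V : Finset (AffineSubspace ℝ (Fin d → ℝ))) : Prop :=
  ∀ p ∈ ratioPairs k d, ∀ U : Set (Fin d → ℝ), IsVarietyOfDegreeLE c U →
    algDim U = (p.2 : WithBot ℕ∞) →
    {v | v ∈ V ∧ algDim ((v : Set (Fin d → ℝ)) ∩ U) = (p.1 : WithBot ℕ∞)}.ncard ≤ q p

end FlatIncidence

end

noncomputable section

open scoped Cardinal

namespace FlatIncidence

/-! ### Krull dimension and coordinates -/

/-! Put a = d' - 1, k = a + r and d = a + r + g + 1; the ratio hypothesis says r < a g. Inside F ≅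
ℝ^(a+1) take the grid points (z, w) with z in [X]^a and w in [(a+1)pX], where p is a prime of size
about X^K, and the n = p²X hyperplanes w = A·z + b with A on the moment curve modulo p. The common
hyperplanes of two points correspond to roots of a nonzero polynomial of degree at most a over `ZMod
p`, so there is no K_{2,a+1}. Every z gives a point on every hyperplane, hence at least n X^a
incidences, of order X^(2K+a+1). With q_{a,a+1} = n, the term of ((k,d), (a,a+1)) has this same
order apart from ε; once q_{a,a+1} is replaced by 1, all terms are smaller by a power of X
(`termExponent_le`).

For k' ≤ a the trivial value q = n is affordable: the product over a sequence telescopes to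
m^(2k_u/(d_u+k_u)) n^(d_u/(d_u+k_u)), which is too small as soon as k_u/d_u < a/(a+1). For k' > a a
saving q ≲ n^(g/(g+1)) is needed. It is a power of n, so it outweighs every other loss when K is
large.

The saving comes from how each hyperplane extends to a k-flat: one slope form, individual to the
flat, and g fiber forms chosen by the base-G digits of its index, G ≈ n^(1/(g+1)). Suppose that many
of these flats meet a variety U of dimension d'' in dimension k' > a (`card_large_intersection_le`).
Each intersection lies over a prime of dimension at least k'. By Vandermonde such a prime contains
few of the linear forms, so on a positive proportion of the flats a random set of forms separates
cleanly, and the digit tree yields L^(g+1) primes with separating polynomials of degree O(L).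
Multiplied by monomials in k' independent coordinates, these make the Hilbert function of U of order
at least L^(g+1+k') at degree O(L). But k'/d'' > k/d forces d'' < g + 1 + k', while the Hilbert
function is O(N^d'') with a constant depending only on c and d (`hilbertFn_variety_le`). A large
fixed L is a contradiction.

The upper bound is uniform because it avoids the ideal of U: U is the zero set of a sum of squares
f, zeros isolated in coordinate fibers are Zariski dense in U, and perturbing f moves them to
critical points satisfying equations of known degree. -/

theorem ringKrullDim_eq_of_isIntegral (R S : Type*) [CommRing R] [CommRing S] [Algebra R S]
    [Algebra.IsIntegral R S] [FaithfulSMul R S] : ringKrullDim S = ringKrullDim R := by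
  apply le_antisymm
  · refine Order.krullDim_le_of_strictMono (PrimeSpectrum.comap (algebraMap R S)) ?_
    intro p q h
    exact Ideal.IsIntegral.comap_lt_comap (R := R) (I := p.asIdeal) (J := q.asIdeal) h
  · refine iSup_le fun l => ?_
    obtain ⟨Q, hQ, hQ'⟩ : Nonempty (Ideal.primesOver (RelSeries.head l).asIdeal S) :=
      inferInstance
    obtain ⟨L, hL, -, -⟩ := Ideal.exists_ltSeries_of_hasGoingUp l Q
    rw [← hL]
    exact Order.LTSeries.length_le_krullDim L

/-- The coordinates generate the quotient, so a transcendence basis can be picked among them.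
Noether normalization gives another basis, whose size is the Krull dimension; bases have equal
cardinality. -/
theorem exists_coordinates_isTranscendenceBasis {σ K : Type} [Fintype σ] [Field K]
    (P : Ideal (MvPolynomial σ K)) [P.IsPrime] :
    ∃ S : Finset σ, ringKrullDim (MvPolynomial σ K ⧸ P) = (S.card : ℕ∞) ∧
      IsTranscendenceBasis K fun j : S => Ideal.Quotient.mk P (MvPolynomial.X (j : σ)) := by
  classical
  set A := MvPolynomial σ K ⧸ P
  let f : σ → A := fun j => Ideal.Quotient.mk P (MvPolynomial.X j)
  have htop : Algebra.adjoin K (Set.range f) = ⊤ := by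
    have h := congrArg (Subalgebra.map (Ideal.Quotient.mkₐ K P))
      (MvPolynomial.adjoin_range_X (R := K) (σ := σ))
    rw [AlgHom.map_adjoin, Algebra.map_top, (AlgHom.range_eq_top _).2
      (Ideal.Quotient.mkₐ_surjective K P), ← Set.range_comp] at h
    exact h
  have halg : Algebra.IsAlgebraic (Algebra.adjoin K (Set.range f)) A := by
    refine ⟨fun x => ?_⟩
    have hx : x ∈ Algebra.adjoin K (Set.range f) := by rw [htop]; trivial
    exact isAlgebraic_algebraMap (⟨x, hx⟩ : Algebra.adjoin K (Set.range f))
  obtain ⟨t, ht, hb⟩ := exists_isTranscendenceBasis_subset (R := K) (Set.range f)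
  obtain ⟨s', -, hs'⟩ := Set.exists_subset_bijOn (f ⁻¹' t) f
  rw [Set.image_preimage_eq_of_subset ht] at hs'
  let S : Finset σ := (Set.toFinite s').toFinset
  have hmem : ∀ j, j ∈ S ↔ j ∈ s' := fun j => Set.Finite.mem_toFinset _
  let e : S ≃ t := (Equiv.subtypeEquivRight hmem).trans hs'.equiv
  have hbS : IsTranscendenceBasis K fun j : S => f j := by
    have : ((↑) : t → A) ∘ e = fun j : S => f j := rfl
    rw [← this, isTranscendenceBasis_equiv e]
    exact hb
  refine ⟨S, ?_, hbS⟩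
  obtain ⟨s, g, hg, hint⟩ := exists_integral_inj_algHom_of_fg K A
  algebraize [g.toRingHom]
  have : FaithfulSMul (MvPolynomial (Fin s) K) A :=
    (faithfulSMul_iff_algebraMap_injective _ _).2 hg
  have hd := ringKrullDim_eq_of_isIntegral (MvPolynomial (Fin s) K) A
  rw [MvPolynomial.ringKrullDim_of_isNoetherianRing, ringKrullDim_eq_zero_of_field, zero_add,
    Nat.card_fin] at hd
  have hcard : S.card = s := by
    have hX : IsTranscendenceBasis K fun i : Fin s => g (MvPolynomial.X i) := by
      rw [isTranscendenceBasis_iff_algebraicIndependent_isAlgebraic]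
      refine ⟨?_, ?_⟩
      · exact (MvPolynomial.algebraicIndependent_X (Fin s) K).map' hg
      · refine ⟨fun x => ?_⟩
        obtain ⟨q, hq, hx⟩ := hint x
        have hr : ∀ y, g y ∈ Algebra.adjoin K (Set.range fun i : Fin s => g (MvPolynomial.X i)) := by
          intro y
          have h := AlgHom.map_adjoin g (Set.range (MvPolynomial.X (R := K) (σ := Fin s)))
          rw [← Set.range_comp, MvPolynomial.adjoin_range_X] at h
          have h2 : g y ∈ Subalgebra.map g ⊤ := ⟨y, trivial, rfl⟩
          rw [h] at h2
          exact h2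
        let g' : MvPolynomial (Fin s) K →+*
            Algebra.adjoin K (Set.range fun i : Fin s => g (MvPolynomial.X i)) :=
          g.toRingHom.codRestrict _ hr
        refine ⟨q.map g', (hq.map g').ne_zero, ?_⟩
        rw [Polynomial.aeval_def, Polynomial.eval₂_map]
        exact hx
    have h := hbS.lift_cardinalMk_eq hX
    simpa using h
  rw [hd, hcard]
  rfl

end FlatIncidence

end

noncomputable section

open MvPolynomial

namespace FlatIncidence

/-! ### Hilbert functions of ideals -/

variable {σ : Type}

/-- The affine Hilbert function of the ideal `J`: the dimension of the space of polynomials of degree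
at most `N`, taken modulo `J`. -/
def hilbertFn (J : Ideal (MvPolynomial σ ℝ)) (N : ℕ) : ℕ :=
  Module.finrank ℝ ((restrictTotalDegree σ ℝ N).map (Ideal.Quotient.mkₐ ℝ J).toLinearMap)

theorem card_le_hilbertFn [Finite σ] {ι : Type} [Fintype ι] {J : Ideal (MvPolynomial σ ℝ)} {N : ℕ}
    (u : ι → MvPolynomial σ ℝ) (hu : ∀ i, (u i).totalDegree ≤ N)
    (hind : ∀ c : ι → ℝ, ∑ i, c i • u i ∈ J → ∀ i, c i = 0) : Fintype.card ι ≤ hilbertFn J N := by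
  let w : ι → ((restrictTotalDegree σ ℝ N).map (Ideal.Quotient.mkₐ ℝ J).toLinearMap) :=
    fun i => ⟨Ideal.Quotient.mkₐ ℝ J (u i),
      Submodule.mem_map_of_mem ((mem_restrictTotalDegree _ _ _).2 (hu i))⟩
  have hw : LinearIndependent ℝ w := by
    rw [Fintype.linearIndependent_iff]
    intro c hc
    apply hind c
    have h := congrArg Subtype.val hc
    rw [← Ideal.Quotient.eq_zero_iff_mem, ← Ideal.Quotient.mkₐ_eq_mk ℝ, map_sum]
    simpa [w] using h
  exact hw.fintype_card_le_finrank

theorem exists_linearIndependent_mod [Finite σ] {J : Ideal (MvPolynomial σ ℝ)} {N M : ℕ}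
    (h : M ≤ hilbertFn J N) : ∃ u : Fin M → MvPolynomial σ ℝ, (∀ i, (u i).totalDegree ≤ N) ∧
      ∀ c : Fin M → ℝ, ∑ i, c i • u i ∈ J → ∀ i, c i = 0 := by
  obtain ⟨w, hw⟩ := exists_linearIndependent_of_le_finrank h
  choose u hu using fun i => (w i).2
  refine ⟨u, fun i => (mem_restrictTotalDegree _ _ _).1 (hu i).1, fun c hc => ?_⟩
  refine Fintype.linearIndependent_iff.1 hw c ?_
  apply Subtype.ext
  rw [← Ideal.Quotient.eq_zero_iff_mem, ← Ideal.Quotient.mkₐ_eq_mk ℝ, map_sum] at hc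
  have hu' : ∀ i, Ideal.Quotient.mkₐ ℝ J (u i) = w i := fun i => (hu i).2
  simpa [hu'] using hc

/-- Rank-nullity for the quotient map on polynomials of degree at most N. Comparisons of Hilbert
functions thus become comparisons of subspaces of one finite-dimensional space. -/
theorem hilbertFn_add_finrank_inf [Finite σ] (J : Ideal (MvPolynomial σ ℝ)) (N : ℕ) :
    hilbertFn J N + Module.finrank ℝ
        (restrictTotalDegree σ ℝ N ⊓ J.restrictScalars ℝ : Submodule ℝ (MvPolynomial σ ℝ)) =
      Module.finrank ℝ (restrictTotalDegree σ ℝ N) := by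
  set W := restrictTotalDegree σ ℝ N
  set f := (Ideal.Quotient.mkₐ ℝ J).toLinearMap
  have h := (f.domRestrict W).finrank_range_add_finrank_ker
  rw [LinearMap.range_domRestrict] at h
  rw [← h, hilbertFn]
  congr 1
  have hk : (W ⊓ J.restrictScalars ℝ) = (LinearMap.ker (f.domRestrict W)).map W.subtype := by
    ext x
    simp only [Submodule.mem_inf, Submodule.restrictScalars_mem, Submodule.mem_map,
      LinearMap.mem_ker, Submodule.subtype_apply, Subtype.exists, LinearMap.domRestrict_apply]
    constructor
    · rintro ⟨hx, hJ⟩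
      exact ⟨x, hx, by simpa [f, Ideal.Quotient.eq_zero_iff_mem] using hJ, rfl⟩
    · rintro ⟨y, hy, h0, rfl⟩
      exact ⟨hy, by simpa [f, Ideal.Quotient.eq_zero_iff_mem] using h0⟩
  rw [hk]
  exact Submodule.finrank_map_subtype_eq _ _

theorem hilbertFn_anti [Finite σ] {I J : Ideal (MvPolynomial σ ℝ)} (h : I ≤ J) (N : ℕ) :
    hilbertFn J N ≤ hilbertFn I N := by
  have h1 := hilbertFn_add_finrank_inf I N
  have h2 := hilbertFn_add_finrank_inf J N
  have h3 : Module.finrank ℝ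
        (restrictTotalDegree σ ℝ N ⊓ I.restrictScalars ℝ : Submodule ℝ (MvPolynomial σ ℝ)) ≤
      Module.finrank ℝ
        (restrictTotalDegree σ ℝ N ⊓ J.restrictScalars ℝ : Submodule ℝ (MvPolynomial σ ℝ)) :=
    Submodule.finrank_mono (inf_le_inf_left _ h)
  omega

theorem hilbertFn_inf_le [Finite σ] (I J : Ideal (MvPolynomial σ ℝ)) (N : ℕ) :
    hilbertFn (I ⊓ J) N ≤ hilbertFn I N + hilbertFn J N := by
  have h1 := hilbertFn_add_finrank_inf I N
  have h2 := hilbertFn_add_finrank_inf J N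
  have h3 := hilbertFn_add_finrank_inf (I ⊓ J) N
  set W := restrictTotalDegree σ ℝ N
  have h4 := Submodule.finrank_sup_add_finrank_inf_eq
    (W ⊓ I.restrictScalars ℝ) (W ⊓ J.restrictScalars ℝ)
  have h5 : Module.finrank ℝ (W ⊓ I.restrictScalars ℝ ⊔ W ⊓ J.restrictScalars ℝ :
      Submodule ℝ (MvPolynomial σ ℝ)) ≤ Module.finrank ℝ W :=
    Submodule.finrank_mono (sup_le inf_le_left inf_le_left)
  have h6 : (W ⊓ I.restrictScalars ℝ) ⊓ (W ⊓ J.restrictScalars ℝ) =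
      W ⊓ (I ⊓ J).restrictScalars ℝ := by
    rw [← inf_inf_distrib_left]
    rfl
  rw [h6] at h4
  omega

theorem hilbertFn_top [Finite σ] (N : ℕ) : hilbertFn (⊤ : Ideal (MvPolynomial σ ℝ)) N = 0 := by
  have h := hilbertFn_add_finrank_inf (⊤ : Ideal (MvPolynomial σ ℝ)) N
  have : (restrictTotalDegree σ ℝ N ⊓ (⊤ : Ideal (MvPolynomial σ ℝ)).restrictScalars ℝ) =
      restrictTotalDegree σ ℝ N := by simp
  rw [this] at h
  omega

theorem hilbertFn_finset_inf_le [Finite σ] {ι : Type} (s : Finset ι)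
    (J : ι → Ideal (MvPolynomial σ ℝ)) (N : ℕ) :
    hilbertFn (s.inf J) N ≤ ∑ i ∈ s, hilbertFn (J i) N := by
  classical
  induction s using Finset.induction_on with
  | empty => simp [hilbertFn_top]
  | insert i s hi ih =>
    rw [Finset.inf_insert, Finset.sum_insert hi]
    exact (hilbertFn_inf_le _ _ _).trans (by omega)

/-- If modulo `J` the `T`-th power of each variable outside `S` is a polynomial of degree less than
`T`, then all polynomials reduce to monomials of degree less than `T` in these variables. -/
theorem hilbertFn_le_of_pow_reduction [Fintype σ] (J : Ideal (MvPolynomial σ ℝ)) (S : Finset σ)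
    {T : ℕ} (hT : 1 ≤ T)
    (hred : ∀ j ∉ S, ∃ r : MvPolynomial σ ℝ, r.totalDegree < T ∧ X j ^ T - r ∈ J) (N : ℕ) :
    hilbertFn J N ≤ T ^ Fintype.card σ * (N + 1) ^ S.card := by
  classical
  let box : Finset (σ → ℕ) := Fintype.piFinset fun j => Finset.range (if j ∈ S then N + 1 else T)
  let mon : (σ → ℕ) → MvPolynomial σ ℝ ⧸ J := fun b =>
    Ideal.Quotient.mk J (monomial (Finsupp.equivFunOnFinite.symm b) 1)
  -- Strong reduction by degree: a monomial outside the box is divisible by some `X j ^ T`, and the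
  -- replacement has strictly smaller degree.
  have key : ∀ n, n ≤ N + 1 → ∀ f : MvPolynomial σ ℝ, (f.totalDegree < n) →
      Ideal.Quotient.mk J f ∈ Submodule.span ℝ (mon '' box) := by
    intro n
    induction n with
    | zero => intro _ f hf; omega
    | succ n ih =>
      intro hn f hf
      have hmon : ∀ b ∈ f.support, Ideal.Quotient.mk J (monomial b (coeff b f)) ∈
          Submodule.span ℝ (mon '' box) := by
        intro b hb
        have hbn : (b.sum fun _ e => e) ≤ n := (le_totalDegree hb).trans (by omega)
        have hbdeg : ∀ j, b j ≤ n := fun j => by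
          refine le_trans ?_ hbn
          rw [Finsupp.sum_fintype _ _ (by simp)]
          exact Finset.single_le_sum (f := fun i => b i) (fun _ _ => Nat.zero_le _)
            (Finset.mem_univ j)
        by_cases hbox : ∀ j ∉ S, b j < T
        · have : Ideal.Quotient.mk J (monomial b (coeff b f)) = coeff b f • mon b := by
            simp only [mon]
            rw [← Ideal.Quotient.mkₐ_eq_mk ℝ, ← map_smul, smul_monomial, smul_eq_mul, mul_one]
            congr 2
            ext; simp
          rw [this]
          refine Submodule.smul_mem _ _ (Submodule.subset_span ⟨b, ?_, rfl⟩)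
          simp only [box, Finset.mem_coe, Fintype.mem_piFinset, Finset.mem_range]
          intro j
          split_ifs with hj
          · have := hbdeg j; omega
          · exact hbox j hj
        · push Not at hbox
          obtain ⟨j, hj, hTj⟩ := hbox
          obtain ⟨r, hr, hrJ⟩ := hred j hj
          have hle : Finsupp.single j T ≤ b := by
            rw [Finsupp.single_le_iff]; exact hTj
          set b' := b - Finsupp.single j T with hb'
          have hbb : b = b' + Finsupp.single j T := (tsub_add_cancel_of_le hle).symm
          have hsum : (b.sum fun _ e => e) = (b'.sum fun _ e => e) + T := by
            rw [hbb, Finsupp.sum_add_index' (by simp) (by simp), Finsupp.sum_single_index rfl]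
          have hmul : monomial b (coeff b f) = monomial b' (coeff b f) * X j ^ T := by
            rw [X_pow_eq_monomial, monomial_mul, mul_one, ← hbb]
          have heq : Ideal.Quotient.mk J (monomial b (coeff b f)) =
              Ideal.Quotient.mk J (monomial b' (coeff b f) * r) := by
            rw [Ideal.Quotient.eq, hmul, ← mul_sub]
            exact J.mul_mem_left _ hrJ
          rw [heq]
          refine ih (by omega) _ ?_
          refine lt_of_le_of_lt (totalDegree_mul _ _) ?_
          have := totalDegree_monomial_le b' (coeff b f)
          simp only [Finsupp.sum, id] at hsum this hbn ⊢
          omega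
      have hf' := f.as_sum
      rw [hf', map_sum]
      exact Submodule.sum_mem _ hmon
  have hle : (restrictTotalDegree σ ℝ N).map (Ideal.Quotient.mkₐ ℝ J).toLinearMap ≤
      Submodule.span ℝ (mon '' box) := by
    rintro _ ⟨f, hf, rfl⟩
    exact key (N + 1) le_rfl f
      (Nat.lt_succ_of_le ((mem_restrictTotalDegree _ _ _).1 hf))
  have hfin : (mon '' box).Finite := box.finite_toSet.image _
  have := FiniteDimensional.span_of_finite ℝ hfin
  calc hilbertFn J N ≤ Module.finrank ℝ (Submodule.span ℝ (mon '' box)) :=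
        Submodule.finrank_mono hle
    _ ≤ box.card := by
        rw [← Finset.coe_image]
        exact (finrank_span_finset_le_card _).trans Finset.card_image_le
    _ = ∏ j, (if j ∈ S then N + 1 else T) := by simp [box, Fintype.card_piFinset]
    _ ≤ T ^ Fintype.card σ * (N + 1) ^ S.card := by
        rw [Finset.prod_ite, Finset.prod_const, Finset.prod_const, mul_comm]
        refine Nat.mul_le_mul (Nat.pow_le_pow_right hT (Finset.card_le_univ _)) ?_
        simp

end FlatIncidence

end

noncomputable section

open MvPolynomial

namespace FlatIncidence

/-! ### Isolated zeros in coordinate fibers -/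

theorem hasDerivAt_eval_update {d : ℕ} (f : MvPolynomial (Fin d) ℝ) (y : Fin d → ℝ) (j : Fin d)
    (t : ℝ) : HasDerivAt (fun s => eval (Function.update y j s) f)
      (eval (Function.update y j t) (pderiv j f)) t := by
  induction f using MvPolynomial.induction_on with
  | C a => simpa using hasDerivAt_const t a
  | add p q hp hq =>
    simp only [map_add]
    exact hp.add hq
  | mul_X p i hp =>
    have hX : HasDerivAt (fun s => Function.update y j s i)
        (eval (Function.update y j t) (pderiv j (X i))) t := by
      by_cases h : i = j
      · subst h
        simp only [Function.update_self, pderiv_X_self, map_one]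
        exact hasDerivAt_id' t
      · simpa [h, pderiv_X_of_ne h] using hasDerivAt_const t (y i)
    have := hp.mul hX
    simp only [Derivation.leibniz, smul_eq_mul, map_add, map_mul, eval_X]
    refine HasDerivAt.congr_deriv this ?_
    ring

theorem totalDegree_pderiv_le {d : ℕ} (f : MvPolynomial (Fin d) ℝ) (j : Fin d) :
    (pderiv j f).totalDegree ≤ f.totalDegree := by
  conv_lhs => rw [f.as_sum, map_sum]
  refine (totalDegree_finsetSum _ _).trans (Finset.sup_le fun b hb => ?_)
  rw [pderiv_monomial]
  refine (totalDegree_monomial_le _ _).trans (le_trans ?_ (le_totalDegree hb))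
  rw [Finsupp.sum_fintype _ _ (by simp), Finsupp.sum_fintype _ _ (by simp)]
  exact Finset.sum_le_sum fun i _ => by simp

theorem mem_vanishingIdeal_iff_eval {d : ℕ} {V : Set (Fin d → ℝ)} {p : MvPolynomial (Fin d) ℝ} :
    p ∈ vanishingIdeal ℝ V ↔ ∀ x ∈ V, eval x p = 0 := by
  simp_rw [← MvPolynomial.coe_aeval_eq_eval]
  rfl

theorem continuous_eval_mvPolynomial {d : ℕ} (f : MvPolynomial (Fin d) ℝ) :
    Continuous fun y : Fin d → ℝ => eval y f := MvPolynomial.continuous_eval f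

open Filter Topology in
/-- A nonnegative polynomial `f` with an isolated zero `a` in a coordinate fiber: small perturbations
of `f` have critical points along the fiber close to `a`. -/
theorem exists_critical_near_isolated_zero {d : ℕ} (f h : MvPolynomial (Fin d) ℝ)
    (hf : ∀ y, 0 ≤ eval y f) (hh : ∀ y, 0 ≤ eval y h) (S : Finset (Fin d)) (a : Fin d → ℝ)
    (ha : eval a f = 0)
    (hiso : ∀ᶠ y in 𝓝 a, (∀ j ∈ S, y j = a j) → eval y f = 0 → y = a)
    {W : Set (Fin d → ℝ)} (hW : W ∈ 𝓝 a) :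
    ∀ᶠ ε : ℝ in 𝓝[>] 0, ∃ y ∈ W, ∀ j ∉ S, eval y (pderiv j (f + C ε * h)) = 0 := by
  obtain ⟨ρ, hρ, hball⟩ := Metric.nhds_basis_closedBall.mem_iff.1 (inter_mem hiso hW)
  set fib : Set (Fin d → ℝ) := {y | ∀ j ∈ S, y j = a j}
  have hfib : IsClosed fib := by
    have : fib = ⋂ j ∈ S, {y | y j = a j} := by ext; simp [fib]
    rw [this]
    exact isClosed_biInter fun j _ => isClosed_eq (continuous_apply j) continuous_const
  have hKc : IsCompact (Metric.closedBall a ρ ∩ fib) := (isCompact_closedBall a ρ).inter_right hfib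
  have hSc : IsCompact (Metric.sphere a ρ ∩ fib) := (isCompact_sphere a ρ).inter_right hfib
  have hpos : ∀ y ∈ Metric.sphere a ρ ∩ fib, 0 < eval y f := by
    rintro y ⟨hy, hyf⟩
    refine lt_of_le_of_ne (hf y) fun h0 => ?_
    have : y = a := (hball (Metric.sphere_subset_closedBall hy)).1 hyf h0.symm
    rw [this, Metric.mem_sphere, dist_self] at hy
    exact hρ.ne hy
  obtain ⟨η, hη, hmin⟩ : ∃ η > 0, ∀ y ∈ Metric.sphere a ρ ∩ fib, η ≤ eval y f := by
    -- The sphere can miss the fiber, for instance when S contains all coordinates; any positive η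
    -- then serves.
    rcases (Metric.sphere a ρ ∩ fib).eq_empty_or_nonempty with he | hne
    · exact ⟨1, one_pos, by simp [he]⟩
    · obtain ⟨y, hy, hmin⟩ := hSc.exists_isMinOn hne (continuous_eval_mvPolynomial f).continuousOn
      exact ⟨_, hpos y hy, fun z hz => hmin hz⟩
  have hev : ∀ᶠ ε : ℝ in 𝓝[>] 0, ε * eval a h < η := by
    have : Tendsto (fun ε : ℝ => ε * eval a h) (𝓝 0) (𝓝 (0 * eval a h)) :=
      (continuous_id.mul continuous_const).tendsto 0
    rw [zero_mul] at this
    exact (this.mono_left nhdsWithin_le_nhds).eventually (gt_mem_nhds hη)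
  filter_upwards [hev, self_mem_nhdsWithin] with ε hε hε0
  have hε0 : 0 < ε := hε0
  set F := f + C ε * h
  have hF : ∀ y, eval y F = eval y f + ε * eval y h := fun y => by simp [F]
  have haK : a ∈ Metric.closedBall a ρ ∩ fib :=
    ⟨Metric.mem_closedBall_self hρ.le, fun _ _ => rfl⟩
  obtain ⟨y, hy, hymin⟩ := hKc.exists_isMinOn ⟨a, haK⟩
    (continuous_eval_mvPolynomial F).continuousOn
  -- On the sphere the perturbed polynomial is at least η, which exceeds its value at a, so its
  -- minimum over the fiber ball is interior.
  have hyint : y ∈ Metric.ball a ρ := by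
    refine lt_of_le_of_ne (Metric.mem_closedBall.1 hy.1) fun heq => ?_
    have h1 := hmin y ⟨heq, hy.2⟩
    have h2 : eval y F ≤ eval a F := hymin haK
    rw [hF, hF, ha] at h2
    have := mul_nonneg hε0.le (hh y)
    linarith
  refine ⟨y, (hball hy.1).2, fun j hj => ?_⟩
  have hder := hasDerivAt_eval_update F y j (y j)
  have hcont : Continuous fun s : ℝ => Function.update y j s := continuous_const.update j continuous_id
  have hnear : ∀ᶠ s in 𝓝 (y j), Function.update y j s ∈ Metric.ball a ρ := by
    refine hcont.continuousAt.eventually (Metric.isOpen_ball.mem_nhds ?_)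
    simpa using hyint
  have hloc : IsLocalMin (fun s => eval (Function.update y j s) F) (y j) := by
    filter_upwards [hnear] with s hs
    rw [Function.update_eq_self]
    refine hymin ⟨Metric.ball_subset_closedBall hs, fun i hi => ?_⟩
    have hij : i ≠ j := fun h => hj (h ▸ hi)
    rw [Function.update_of_ne hij]
    exact hy.2 i hi
  have := hloc.hasDerivAt_eq_zero hder
  rwa [Function.update_eq_self] at this

open Filter Topology in
/-- The Hilbert function of the set of zeros of a nonnegative polynomial that are isolated in their
fiber over the coordinates in `S` grows at most like `N ^ |S|`. -/
theorem hilbertFn_isolated_le {d c : ℕ} (f : MvPolynomial (Fin d) ℝ) (hf : ∀ y, 0 ≤ eval y f)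
    (hdeg : f.totalDegree ≤ 2 * c) (S : Finset (Fin d)) (N : ℕ) :
    hilbertFn (vanishingIdeal ℝ {a : Fin d → ℝ | eval a f = 0 ∧
      ∀ᶠ y in 𝓝 a, (∀ j ∈ S, y j = a j) → eval y f = 0 → y = a}) N ≤
      (2 * c + 1) ^ d * (N + 1) ^ S.card := by
  classical
  set A := {a : Fin d → ℝ | eval a f = 0 ∧
      ∀ᶠ y in 𝓝 a, (∀ j ∈ S, y j = a j) → eval y f = 0 → y = a}
  set M := (2 * c + 1) ^ d * (N + 1) ^ S.card
  by_contra hcon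
  obtain ⟨u, hu, hind⟩ := exists_linearIndependent_mod (M := M + 1) (not_le.1 hcon)
  let w : (Fin d → ℝ) → (Fin (M + 1) → ℝ) := fun a i => eval a (u i)
  have hwc : Continuous w := continuous_pi fun i => continuous_eval_mvPolynomial _
  -- A functional vanishing on all evaluation vectors would be a linear relation among the u modulo
  -- the ideal of A. Hence M + 1 points of A have independent evaluation vectors, and by openness
  -- independence survives small moves of the points.
  have hspan : Submodule.span ℝ (w '' A) = ⊤ := by
    by_contra hne
    obtain ⟨φ, hφ, hle⟩ := Submodule.exists_le_ker_of_lt_top _ (lt_top_iff_ne_top.2 hne)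
    have hφs := fun v => LinearMap.pi_apply_eq_sum_univ φ v
    have hz := hind (fun i => φ fun j => if i = j then 1 else 0) (by
      rw [mem_vanishingIdeal_iff_eval]
      intro a ha
      have h0 : φ (w a) = 0 := hle (Submodule.subset_span ⟨a, ha, rfl⟩)
      rw [hφs] at h0
      rw [map_sum]
      refine Eq.trans (Finset.sum_congr rfl fun i _ => ?_) h0
      rw [smul_eval, smul_eq_mul, mul_comm])
    refine hφ (LinearMap.ext fun v => ?_)
    rw [hφs, LinearMap.zero_apply]
    exact Finset.sum_eq_zero fun i _ => by rw [hz, smul_zero]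
  obtain ⟨pts, hptsA, hptsI⟩ : ∃ pts : Fin (M + 1) → (Fin d → ℝ), (∀ i, pts i ∈ A) ∧
      LinearIndependent ℝ fun i => w (pts i) := by
    obtain ⟨b, hbA, hbs, hbi⟩ := exists_linearIndependent ℝ (w '' A)
    let B : Module.Basis b ℝ (Fin (M + 1) → ℝ) := Module.Basis.mk hbi (by
      rw [Subtype.range_coe, hbs, hspan])
    let e := (Pi.basisFun ℝ (Fin (M + 1))).indexEquiv B
    choose pts hpts using fun i => hbA (e i).2
    refine ⟨pts, fun i => (hpts i).1, ?_⟩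
    have : (fun i => w (pts i)) = ((↑) : b → _) ∘ e := funext fun i => (hpts i).2
    rw [this]
    exact hbi.comp e e.injective
  obtain ⟨s, hs⟩ : ∃ s : Fin (M + 1) → Set (Fin d → ℝ), (∀ i, s i ∈ 𝓝 (pts i)) ∧
      ∀ y : Fin (M + 1) → (Fin d → ℝ), (∀ i, y i ∈ s i) → LinearIndependent ℝ fun i => w (y i) := by
    have hcont : Continuous fun y : Fin (M + 1) → (Fin d → ℝ) => fun i => w (y i) :=
      continuous_pi fun i => hwc.comp (continuous_apply i)
    have hev := (hcont.continuousAt (x := pts)).eventually hptsI.eventually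
    rw [nhds_pi] at hev
    obtain ⟨I, t, ht, hsub⟩ := Filter.mem_pi'.1 hev
    exact ⟨t, ht, fun y hy => hsub fun i _ => hy i⟩
  -- The exponent is even, so h is nonnegative, and its derivative has degree 2c + 1, more than that
  -- of any derivative of f. At critical points of f + εh each `X j ^ (2c+1)` with j outside S
  -- therefore reduces to lower degree.
  set h : MvPolynomial (Fin d) ℝ := ∑ j ∈ Sᶜ, X j ^ (2 * c + 2)
  have hh : ∀ y, 0 ≤ eval y h := fun y => by
    simp only [h, map_sum, map_pow, eval_X]
    exact Finset.sum_nonneg fun j _ => by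
      rw [show 2 * c + 2 = 2 * (c + 1) by ring, pow_mul]; positivity
  have hall : ∀ᶠ ε : ℝ in 𝓝[>] 0, ∀ i, ∃ y ∈ s i, ∀ j ∉ S, eval y (pderiv j (f + C ε * h)) = 0 :=
    eventually_all.2 fun i => exists_critical_near_isolated_zero f h hf hh S (pts i)
      (hptsA i).1 (hptsA i).2 (hs.1 i)
  obtain ⟨ε, hε, hε0⟩ := (hall.and self_mem_nhdsWithin).exists
  have hε0 : 0 < ε := hε0
  choose y hys hyc using hε
  have hyI := hs.2 y hys
  let J : Ideal (MvPolynomial (Fin d) ℝ) := vanishingIdeal ℝ (Set.range y)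
  have hJ : hilbertFn J N ≤ M := by
    refine (hilbertFn_le_of_pow_reduction J S (T := 2 * c + 1) (by omega) ?_ N).trans (by simp [M])
    intro j hj
    have hph : pderiv j h = C ((2 * c + 2 : ℕ) : ℝ) * X j ^ (2 * c + 1) := by
      simp only [h, map_sum]
      rw [Finset.sum_eq_single j]
      · rw [pderiv_pow, pderiv_X_self, mul_one, map_natCast]
        rfl
      · intro i _ hij
        rw [pderiv_pow, pderiv_X_of_ne hij, mul_zero]
      · intro h; simp [hj] at h
    refine ⟨C (-(ε * ((2 * c + 2 : ℕ) : ℝ))⁻¹) * pderiv j f, ?_, ?_⟩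
    · refine lt_of_le_of_lt (totalDegree_mul _ _) ?_
      rw [totalDegree_C, zero_add]
      exact lt_of_le_of_lt ((totalDegree_pderiv_le f j).trans hdeg) (by omega)
    · rw [mem_vanishingIdeal_iff_eval]
      rintro _ ⟨i, rfl⟩
      have h0 := hyc i j hj
      rw [map_add, pderiv_C_mul, hph] at h0
      simp only [map_add, map_mul, eval_C, map_pow, eval_X] at h0
      simp only [map_sub, map_mul, map_pow, eval_X, eval_C]
      have h2 : (ε * ((2 * c + 2 : ℕ) : ℝ)) ≠ 0 := by positivity
      have : eval (y i) (pderiv j f) = -(ε * ((2 * c + 2 : ℕ) : ℝ)) * y i j ^ (2 * c + 1) := by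
        linarith
      rw [this]
      field_simp
      ring
  -- The u stay independent modulo the ideal of the moved points, giving M + 1 ≤ M.
  have hcard := card_le_hilbertFn (J := J) u hu (by
    intro κ hκ
    rw [mem_vanishingIdeal_iff_eval] at hκ
    have hdot : ∀ i, ∑ l, κ l * w (y i) l = 0 := fun i => by
      have := hκ (y i) ⟨i, rfl⟩
      rw [map_sum] at this
      rw [← this]
      exact Finset.sum_congr rfl fun l _ => by rw [smul_eval]
    let ψ : (Fin (M + 1) → ℝ) →ₗ[ℝ] ℝ := ∑ l, κ l • LinearMap.proj l
    have hψ : ∀ v, ψ v = ∑ l, κ l * v l := fun v => by simp [ψ]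
    have htop : Submodule.span ℝ (Set.range fun i => w (y i)) = ⊤ :=
      hyI.span_eq_top_of_card_eq_finrank' (by simp)
    have hker : (⊤ : Submodule ℝ (Fin (M + 1) → ℝ)) ≤ LinearMap.ker ψ := by
      rw [← htop, Submodule.span_le]
      rintro _ ⟨i, rfl⟩
      simp [hψ, hdot]
    intro l
    have := hker (show Pi.single l 1 ∈ ⊤ from trivial)
    rw [LinearMap.mem_ker, hψ] at this
    simpa [Pi.single_apply] using this)
  simp at hcard
  omega

end FlatIncidence

end

noncomputable section

open MvPolynomial

namespace FlatIncidence

/-! ### The Hilbert function of a real variety of bounded degree -/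

open Filter Topology in
/-- If `x j` is algebraic over the coordinates in `S` modulo the prime `P`, then generic zeros of `P`
have isolated `j`-th coordinate in the fiber over the coordinates in `S`. -/
theorem exists_coordinate_isolated {d : ℕ} (P : Ideal (MvPolynomial (Fin d) ℝ)) [P.IsPrime]
    (S : Finset (Fin d))
    (hS : IsTranscendenceBasis ℝ fun j : S => Ideal.Quotient.mk P (X (j : Fin d))) (j : Fin d) :
    ∃ l : MvPolynomial (Fin d) ℝ, l ∉ P ∧ ∀ x : Fin d → ℝ, eval x l ≠ 0 →
      ∀ᶠ y in 𝓝 x, (∀ i ∈ S, y i = x i) → (∀ p ∈ P, eval y p = 0) → y j = x j := by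
  set ι : MvPolynomial S ℝ →ₐ[ℝ] MvPolynomial (Fin d) ℝ := rename (↑)
  have hcomp : ∀ p, aeval (R := ℝ) (fun i : S => Ideal.Quotient.mk P (X (i : Fin d))) p =
      Ideal.Quotient.mk P (ι p) := by
    intro p
    have : aeval (R := ℝ) (fun i : S => Ideal.Quotient.mk P (X (i : Fin d))) =
        (Ideal.Quotient.mkₐ ℝ P).comp ι := by
      ext i
      simp [ι]
    rw [this]
    rfl
  obtain ⟨q, hq0, hq⟩ : ∃ q : Polynomial (MvPolynomial S ℝ), q ≠ 0 ∧
      q.eval₂ ι.toRingHom (X j) ∈ P := by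
    have halg := hS.isAlgebraic.isAlgebraic (Ideal.Quotient.mk P (X j))
    obtain ⟨q, hq0, hq⟩ := halg
    let e := hS.1.aevalEquiv
    refine ⟨q.map (e.symm : _ →+* _), ?_, ?_⟩
    · rwa [Ne, Polynomial.map_eq_zero_iff]
      exact e.symm.injective
    · rw [← Ideal.Quotient.eq_zero_iff_mem, Polynomial.hom_eval₂, Polynomial.eval₂_map, ← hq,
        Polynomial.aeval_def]
      congr 1
      ext r
      obtain ⟨p, rfl⟩ := e.surjective r
      have h1 := hcomp p
      have h2 := hS.1.algebraMap_aevalEquiv p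
      simp only [RingHom.comp_apply]
      change _ = algebraMap _ _ (e p)
      rw [h2, h1]
      simp
  -- Where the leading coefficient does not vanish, the specialized q is a nonzero univariate
  -- polynomial, so the j-th coordinate has finitely many possible values on the fiber.
  refine ⟨ι q.leadingCoeff, ?_, ?_⟩
  · rw [← Ideal.Quotient.eq_zero_iff_mem, ← hcomp]
    intro h0
    have := hS.1
    rw [algebraicIndependent_iff] at this
    exact hq0 (Polynomial.leadingCoeff_eq_zero.1 (this _ h0))
  · intro x hx
    have hev : ∀ (y : Fin d → ℝ) (p : MvPolynomial S ℝ), eval y (ι p) = eval (fun i : S => y i) p :=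
      fun y p => by rw [eval_rename]; rfl
    set q' : Polynomial ℝ := q.map (eval fun i : S => x i)
    have hq' : q' ≠ 0 := by
      intro h0
      have := congrArg (fun r => r.coeff q.natDegree) h0
      simp only [q', Polynomial.coeff_map, Polynomial.coeff_zero] at this
      rw [hev] at hx
      exact hx this
    have hroot : ∀ y : Fin d → ℝ, (∀ i ∈ S, y i = x i) → (∀ p ∈ P, eval y p = 0) →
        y j ∈ {t | q'.IsRoot t} := by
      intro y hy hyP
      have h0 := hyP _ hq
      rw [Polynomial.hom_eval₂, eval_X] at h0
      have h1 : (eval y).comp ι.toRingHom = eval fun i : S => x i := by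
        have hyx : (fun i : S => y i) = fun i : S => x i := funext fun i => hy i i.2
        rw [← hyx]
        exact RingHom.ext fun p => hev y p
      rw [h1] at h0
      simpa [q', Polynomial.IsRoot, Polynomial.eval_map] using h0
    have hfin : {t | q'.IsRoot t}.Finite := Polynomial.finite_setOfPred_isRoot hq'
    have hopen : ∀ᶠ t in 𝓝 (x j), t ∉ {t | q'.IsRoot t} \ {x j} :=
      ((hfin.subset Set.sdiff_subset).isClosed.isOpen_compl).mem_nhds (by simp)
    filter_upwards [(continuous_apply j).continuousAt.eventually hopen] with y hy hyS hyP
    by_contra hne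
    exact hy ⟨hroot y hyS hyP, hne⟩

theorem isRadical_vanishingIdeal {d : ℕ} (U : Set (Fin d → ℝ)) :
    (vanishingIdeal ℝ U : Ideal (MvPolynomial (Fin d) ℝ)).IsRadical := by
  rintro p ⟨n, hn⟩
  rw [mem_vanishingIdeal_iff_eval] at hn ⊢
  intro x hx
  have := hn x hx
  rw [map_pow] at this
  by_contra h
  exact pow_ne_zero n h this

open Filter Topology in
/-- Points of `U` that are isolated in a coordinate fiber over at most `δ` coordinates are Zariski
dense in a variety `U` of dimension at most `δ`. -/
theorem mem_vanishingIdeal_of_isolated {d δ : ℕ} (f : MvPolynomial (Fin d) ℝ)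
    (hdim : algDim {x : Fin d → ℝ | eval x f = 0} ≤ (δ : ℕ∞)) (p : MvPolynomial (Fin d) ℝ)
    (hp : ∀ S : Finset (Fin d), S.card ≤ δ → ∀ a : Fin d → ℝ, eval a f = 0 →
      (∀ᶠ y in 𝓝 a, (∀ j ∈ S, y j = a j) → eval y f = 0 → y = a) → eval a p = 0) :
    p ∈ vanishingIdeal ℝ {x : Fin d → ℝ | eval x f = 0} := by
  classical
  set U := {x : Fin d → ℝ | eval x f = 0}
  set I : Ideal (MvPolynomial (Fin d) ℝ) := vanishingIdeal ℝ U
  have hrad : I.radical = I := (isRadical_vanishingIdeal U).radical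
  rw [← hrad, ← Ideal.sInf_minimalPrimes, Ideal.mem_sInf]
  intro P hP
  have hPp : P.IsPrime := hP.1.1
  obtain ⟨S, hcard, hS⟩ := exists_coordinates_isTranscendenceBasis P
  have hSδ : S.card ≤ δ := by
    have h1 : ringKrullDim (MvPolynomial (Fin d) ℝ ⧸ P) ≤
        ringKrullDim (MvPolynomial (Fin d) ℝ ⧸ I) :=
      ringKrullDim_le_of_surjective _ (Ideal.Quotient.factor_surjective hP.1.2)
    rw [hcard] at h1
    exact_mod_cast h1.trans hdim
  have hfin := I.finite_minimalPrimes_of_isNoetherianRing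
  -- G vanishes on the other components of U; where it is nonzero, U is cut out by P alone.
  obtain ⟨G, hG, hGP⟩ : ∃ G, G ∈ (hfin.toFinset.erase P).inf id ∧ G ∉ P := by
    by_contra hcon
    push Not at hcon
    obtain ⟨Q, hQ, hQP⟩ := (Ideal.IsPrime.inf_le' hPp).1 hcon
    rw [Finset.mem_erase, Set.Finite.mem_toFinset] at hQ
    exact hQ.1 (le_antisymm hQP (hP.2 hQ.2.1 hQP))
  have hPG : ∀ y ∈ U, eval y G ≠ 0 → ∀ g ∈ P, eval y g = 0 := by
    intro y hy hyG g hg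
    have : g * G ∈ I := by
      rw [← hrad, ← Ideal.sInf_minimalPrimes, Ideal.mem_sInf]
      intro Q hQ
      by_cases hQP : Q = P
      · exact hQP ▸ P.mul_mem_right _ hg
      · refine Q.mul_mem_left _ ?_
        exact Finset.inf_le (f := id) (b := Q)
          (Finset.mem_erase.2 ⟨hQP, hfin.mem_toFinset.2 hQ⟩) hG
    have h0 := mem_vanishingIdeal_iff_eval.1 this y hy
    rw [map_mul] at h0
    exact (mul_eq_zero.1 h0).resolve_right hyG
  choose l hlP hl using exists_coordinate_isolated P S hS
  -- At a point of U where G and all l j are nonzero, every coordinate is isolated in the fiber over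
  -- S, so p vanishes there by hypothesis. Primality then removes the factors outside P.
  have hprod : p * (G * ∏ j, l j) ∈ P := by
    refine hP.1.2 (mem_vanishingIdeal_iff_eval.2 fun x hx => ?_)
    by_cases h0 : eval x (G * ∏ j, l j) = 0
    · rw [map_mul, h0, mul_zero]
    · rw [map_mul, mul_eq_zero, not_or, map_prod, Finset.prod_eq_zero_iff] at h0
      obtain ⟨hxG, hxl⟩ := h0
      push Not at hxl
      rw [map_mul, hp S hSδ x hx, zero_mul]
      have hnear : ∀ᶠ y in 𝓝 x, eval y G ≠ 0 :=
        (continuous_eval_mvPolynomial G).continuousAt.eventually_ne hxG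
      have hcoord : ∀ᶠ y in 𝓝 x, ∀ j, (∀ i ∈ S, y i = x i) → (∀ p ∈ P, eval y p = 0) →
          y j = x j :=
        eventually_all.2 fun j => hl j x (hxl j (Finset.mem_univ j))
      filter_upwards [hnear, hcoord] with y hyG hy hyS hyU
      exact funext fun j => hy j hyS (hPG y hyU hyG)
  rcases hPp.mem_or_mem hprod with h | h
  · exact h
  · rcases hPp.mem_or_mem h with h | h
    · exact absurd h hGP
    · obtain ⟨j, -, hj⟩ := hPp.prod_mem_iff.1 h
      exact absurd hj (hlP j)

/-- The Hilbert function of a real variety of degree at most `c` and dimension at most `δ` is bounded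
by a constant times `N ^ δ`, where the constant depends only on `c` and the ambient dimension. -/
theorem hilbertFn_variety_le {d c δ : ℕ} {U : Set (Fin d → ℝ)} (hU : IsVarietyOfDegreeLE c U)
    (hdim : algDim U ≤ (δ : ℕ∞)) (N : ℕ) :
    hilbertFn (vanishingIdeal ℝ U) N ≤ 2 ^ d * ((2 * c + 1) ^ d * (N + 1) ^ δ) := by
  classical
  obtain ⟨F, hF, rfl⟩ := hU
  -- Over ℝ one nonnegative polynomial of degree at most 2c defines U, however many equations were
  -- given.
  set f : MvPolynomial (Fin d) ℝ := ∑ g ∈ F, g ^ 2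
  have hpos : ∀ y, 0 ≤ eval y f := fun y => by
    simp only [f, map_sum, map_pow]
    exact Finset.sum_nonneg fun _ _ => sq_nonneg _
  have hdeg : f.totalDegree ≤ 2 * c := by
    refine (totalDegree_finsetSum _ _).trans (Finset.sup_le fun g hg => ?_)
    exact (totalDegree_pow _ _).trans (Nat.mul_le_mul_left 2 (hF g hg))
  have hzero : {x : Fin d → ℝ | ∀ g ∈ F, eval x g = 0} = {x | eval x f = 0} := by
    ext x
    simp only [f, Set.mem_ofPred_eq, map_sum, map_pow]
    rw [Finset.sum_eq_zero_iff_of_nonneg fun _ _ => sq_nonneg _]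
    simp
  rw [hzero] at hdim ⊢
  let T : Finset (Finset (Fin d)) := Finset.univ.filter fun S => S.card ≤ δ
  let A : Finset (Fin d) → Ideal (MvPolynomial (Fin d) ℝ) := fun S =>
    vanishingIdeal ℝ {a : Fin d → ℝ | eval a f = 0 ∧
      ∀ᶠ y in nhds a, (∀ j ∈ S, y j = a j) → eval y f = 0 → y = a}
  have hle : T.inf A ≤ vanishingIdeal ℝ {x : Fin d → ℝ | eval x f = 0} := by
    intro p hp
    refine mem_vanishingIdeal_of_isolated f hdim p fun S hS a ha hiso => ?_
    have : p ∈ A S := Finset.inf_le (f := A) (Finset.mem_filter.2 ⟨Finset.mem_univ S, hS⟩) hp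
    exact mem_vanishingIdeal_iff_eval.1 this a ⟨ha, hiso⟩
  calc hilbertFn (vanishingIdeal ℝ {x : Fin d → ℝ | eval x f = 0}) N
      ≤ hilbertFn (T.inf A) N := hilbertFn_anti hle N
    _ ≤ ∑ S ∈ T, hilbertFn (A S) N := hilbertFn_finset_inf_le _ _ _
    _ ≤ ∑ S ∈ T, (2 * c + 1) ^ d * (N + 1) ^ δ := by
        refine Finset.sum_le_sum fun S hS => (hilbertFn_isolated_le f hpos hdeg S N).trans ?_
        exact Nat.mul_le_mul_left _ (Nat.pow_le_pow_right (by omega) (Finset.mem_filter.1 hS).2)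
    _ ≤ 2 ^ d * ((2 * c + 1) ^ d * (N + 1) ^ δ) := by
        rw [Finset.sum_const, smul_eq_mul]
        refine Nat.mul_le_mul_right _ ((Finset.card_filter_le _ _).trans ?_)
        simp

end FlatIncidence

end

noncomputable section

open MvPolynomial

namespace FlatIncidence

/-! ### Many primes with separating polynomials force a large Hilbert function -/

/-- The smallest prime of a chain of length n above I carries the whole chain. -/
theorem exists_isPrime_le_ringKrullDim {R : Type} [CommRing R] (I : Ideal R) {n : ℕ}
    (h : (n : WithBot ℕ∞) ≤ ringKrullDim (R ⧸ I)) :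
    ∃ P : Ideal R, P.IsPrime ∧ I ≤ P ∧ (n : WithBot ℕ∞) ≤ ringKrullDim (R ⧸ P) := by
  rw [ringKrullDim_quotient] at h
  obtain ⟨l, hl⟩ := Order.le_krullDim_iff.1 h
  refine ⟨(RelSeries.head l).1.asIdeal, (RelSeries.head l).1.2, (RelSeries.head l).2, ?_⟩
  rw [ringKrullDim_quotient]
  refine Order.le_krullDim_iff.2 ⟨⟨l.length, fun i => ⟨(l i).1, ?_⟩, fun i => l.step i⟩, hl⟩
  exact LTSeries.head_le l i

theorem exists_monomials_linearIndependent {σ : Type} [Fintype σ] (P : Ideal (MvPolynomial σ ℝ))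
    [P.IsPrime] {n : ℕ} (hP : (n : WithBot ℕ∞) ≤ ringKrullDim (MvPolynomial σ ℝ ⧸ P)) (L : ℕ) :
    ∃ u : (Fin n → Fin (L + 1)) → MvPolynomial σ ℝ, (∀ b, (u b).totalDegree ≤ n * L) ∧
      ∀ c : (Fin n → Fin (L + 1)) → ℝ, ∑ b, c b • u b ∈ P → ∀ b, c b = 0 := by
  classical
  obtain ⟨S, hS, hb⟩ := exists_coordinates_isTranscendenceBasis P
  have hn : n ≤ S.card := by rw [hS] at hP; exact_mod_cast hP
  obtain ⟨v⟩ : Nonempty (Fin n ↪ S) := Function.Embedding.nonempty_of_card_le (by simpa using hn)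
  have hind := hb.1.comp v v.injective
  let m : (Fin n → Fin (L + 1)) → (Fin n →₀ ℕ) := fun b =>
    Finsupp.equivFunOnFinite.symm fun i => (b i : ℕ)
  have hm : Function.Injective m := by
    intro b b' h
    funext i
    have := DFunLike.congr_fun h i
    exact Fin.ext (by simpa [m] using this)
  let ι : MvPolynomial (Fin n) ℝ →ₐ[ℝ] MvPolynomial σ ℝ := rename fun i => (v i : σ)
  refine ⟨fun b => ι (monomial (m b) 1), fun b => ?_, fun c hc => ?_⟩
  · refine (totalDegree_rename_le _ _).trans ((totalDegree_monomial_le _ _).trans ?_)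
    rw [Finsupp.sum_fintype _ _ (by simp)]
    calc ∑ i, m b i ≤ ∑ _i : Fin n, L := Finset.sum_le_sum fun i _ => by
          simpa [m] using Nat.le_of_lt_succ (b i).2
      _ = n * L := by simp
  · have hcomp : ∀ p, aeval (R := ℝ) ((fun i : S => Ideal.Quotient.mk P (X (i : σ))) ∘ v) p =
        Ideal.Quotient.mk P (ι p) := by
      intro p
      have : aeval (R := ℝ) ((fun i : S => Ideal.Quotient.mk P (X (i : σ))) ∘ v) =
          (Ideal.Quotient.mkₐ ℝ P).comp ι := by
        ext i
        simp [ι]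
      rw [this]
      rfl
    have h0 : ∑ b, c b • monomial (m b) (1 : ℝ) = 0 := by
      rw [algebraicIndependent_iff] at hind
      apply hind
      rw [hcomp, Ideal.Quotient.eq_zero_iff_mem, map_sum]
      simpa using hc
    have hli : LinearIndependent ℝ fun b => (monomial (m b) (1 : ℝ) : MvPolynomial (Fin n) ℝ) :=
      (basisMonomials (Fin n) ℝ).linearIndependent.comp m hm
    exact Fintype.linearIndependent_iff.1 hli c h0

/-- For each prime take monomials in n coordinates independent modulo it and multiply them by φ i.
In a relation modulo J, reduction modulo P i kills the terms of all other indices, and φ i cancels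
because it is not in P i. -/
theorem card_mul_le_hilbertFn {σ ι : Type} [Fintype σ] (J : Ideal (MvPolynomial σ ℝ))
    (T : Finset ι) (P : ι → Ideal (MvPolynomial σ ℝ)) (hP : ∀ i ∈ T, (P i).IsPrime)
    (hJ : ∀ i ∈ T, J ≤ P i) {n : ℕ}
    (hdim : ∀ i ∈ T, (n : WithBot ℕ∞) ≤ ringKrullDim (MvPolynomial σ ℝ ⧸ P i))
    (φ : ι → MvPolynomial σ ℝ) {M : ℕ} (hdeg : ∀ i ∈ T, (φ i).totalDegree ≤ M)
    (hφ : ∀ i ∈ T, ∀ i' ∈ T, φ i ∈ P i' ↔ i ≠ i') (L : ℕ) :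
    T.card * (L + 1) ^ n ≤ hilbertFn J (M + n * L) := by
  classical
  have hex : ∀ i : T, ∃ u : (Fin n → Fin (L + 1)) → MvPolynomial σ ℝ,
      (∀ b, (u b).totalDegree ≤ n * L) ∧
      ∀ c : (Fin n → Fin (L + 1)) → ℝ, ∑ b, c b • u b ∈ P i → ∀ b, c b = 0 := fun i => by
    have := hP i i.2
    exact exists_monomials_linearIndependent (P i) (hdim i i.2) L
  choose u hu hind using hex
  have h := card_le_hilbertFn (J := J) (N := M + n * L)
    (fun x : T × (Fin n → Fin (L + 1)) => φ x.1 * u x.1 x.2)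
    (fun x => (totalDegree_mul _ _).trans (Nat.add_le_add (hdeg _ x.1.2) (hu _ _))) (by
      intro c hc
      rintro ⟨i, b⟩
      have hPi := hP i i.2
      refine hind i (fun b => c (i, b)) ?_ b
      have h1 : φ i * ∑ b, c (i, b) • u i b ∈ P i := by
        have h2 := hJ i i.2 hc
        rw [Fintype.sum_prod_type, ← Finset.add_sum_erase _ _ (Finset.mem_univ i)] at h2
        have h3 : ∑ x ∈ Finset.univ.erase i, ∑ b, c (x, b) • (φ x * u x b) ∈ P i := by
          refine Ideal.sum_mem _ fun x hx => Ideal.sum_mem _ fun b _ => ?_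
          rw [smul_eq_C_mul]
          refine Ideal.mul_mem_left _ _ (Ideal.mul_mem_right _ _ ?_)
          rw [hφ x x.2 i i.2]
          exact fun h => (Finset.mem_erase.1 hx).1 (Subtype.ext h)
        have h4 := (Ideal.add_mem_iff_left _ h3).1 h2
        rw [Finset.mul_sum]
        convert h4 using 2 with b
        rw [mul_smul_comm]
      exact (hPi.mem_or_mem h1).resolve_left fun h => (hφ i i.2 i i.2).1 h rfl)
  simpa using h

/-- A large finite family of primes, each labelled by a branch of a tree with at most `G` children at
every node, contains a subfamily of size `L ^ J` with separating polynomials of degree at most `J * L`,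
provided that distinct children of a node are separated by linear forms. -/
theorem exists_separated_subfamily {σ ι : Type} (P : ι → Ideal (MvPolynomial σ ℝ)) (G L : ℕ) :
    ∀ (J : ℕ) (lab : ℕ → ι → ℕ) (form : ℕ → ι → MvPolynomial σ ℝ) (B : Finset ι),
      (∀ i ∈ B, (P i).IsPrime) →
      (∀ j < J, ∀ i ∈ B, lab j i < G) →
      (∀ i ∈ B, ∀ i' ∈ B, (∀ j < J, lab j i = lab j i') → i = i') →
      (∀ j i, (form j i).totalDegree ≤ 1) →
      (∀ j < J, ∀ i ∈ B, ∀ i' ∈ B, (∀ j' < j, lab j' i = lab j' i') →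
        (form j i' ∈ P i ↔ lab j i = lab j i')) →
      J * L * G ^ (J - 1) < B.card →
      ∃ T ⊆ B, T.card = L ^ J ∧ ∃ φ : ι → MvPolynomial σ ℝ,
        (∀ i ∈ T, (φ i).totalDegree ≤ J * L) ∧ ∀ i ∈ T, ∀ i' ∈ T, φ i ∈ P i' ↔ i ≠ i' := by
  classical
  intro J
  induction J with
  | zero =>
    intro lab form B hP _ hinj _ _ hB
    have hB' : 0 < B.card := by simpa using hB
    obtain ⟨i, hi⟩ := Finset.card_pos.1 hB'
    refine ⟨{i}, by simpa using hi, by simp, fun _ => 1, by simp, ?_⟩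
    simp only [Finset.mem_singleton]
    rintro _ rfl _ rfl
    simpa using (Ideal.ne_top_iff_one _).1 (hP _ hi).ne_top
  | succ J ih =>
    intro lab form B hP hlab hinj hdeg hform hB
    let cls : ℕ → Finset ι := fun x => B.filter fun i => lab 0 i = x
    have hcls : ∀ {x i}, i ∈ cls x ↔ i ∈ B ∧ lab 0 i = x := Finset.mem_filter
    have hclsB : ∀ x, cls x ⊆ B := fun x => Finset.filter_subset _ _
    have hagree : ∀ {x j}, ∀ i ∈ cls x, ∀ i' ∈ cls x,
        (∀ j' < j, lab (j' + 1) i = lab (j' + 1) i') → ∀ j' < j + 1, lab j' i = lab j' i' := by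
      intro x j i hi i' hi' h j' hj'
      cases j' with
      | zero => rw [(hcls.1 hi).2, (hcls.1 hi').2]
      | succ j' => exact h j' (by omega)
    have hsmall : ∀ x, (cls x).card ≤ G ^ J := by
      intro x
      let f : ι → (Fin J → ℕ) := fun i j => lab (j + 1) i
      have himg : (cls x).image f ⊆ Fintype.piFinset fun _ : Fin J => Finset.range G := by
        intro y hy
        obtain ⟨i, hi, rfl⟩ := Finset.mem_image.1 hy
        simp only [Fintype.mem_piFinset, Finset.mem_range, f]
        exact fun j => hlab _ (by omega) i (hclsB x hi)
      have hfinj : Set.InjOn f (cls x) := fun i hi i' hi' h =>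
        hinj i (hclsB x hi) i' (hclsB x hi') (hagree i hi i' hi' fun j hj =>
          congrFun h ⟨j, hj⟩)
      rw [← Finset.card_image_of_injOn hfinj]
      refine (Finset.card_le_card himg).trans ?_
      simp [Fintype.card_piFinset]
    -- The classes large enough for the induction hypothesis. Fewer than L of them would give at
    -- most G · (J L G^(J-1)) + L · G^J = (J+1) L G^J members in all.
    let Y := (Finset.range G).filter fun x => J * L * G ^ (J - 1) < (cls x).card
    have hY : L ≤ Y.card := by
      by_contra hlt
      have hsum : B.card = ∑ x ∈ Finset.range G, (cls x).card :=
        Finset.card_eq_sum_card_fiberwise fun i hi => by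
          simpa using hlab 0 (by omega) i hi
      have hle : ∑ x ∈ Finset.range G, (cls x).card ≤
          ∑ x ∈ Finset.range G, (J * L * G ^ (J - 1) + if x ∈ Y then G ^ J else 0) := by
        refine Finset.sum_le_sum fun x hx => ?_
        split_ifs with hxY
        · exact (hsmall x).trans (by omega)
        · have : ¬ (J * L * G ^ (J - 1) < (cls x).card) := fun h =>
            hxY (Finset.mem_filter.2 ⟨hx, h⟩)
          omega
      rw [Finset.sum_add_distrib, Finset.sum_const, Finset.card_range, smul_eq_mul,
        ← Finset.sum_filter, Finset.sum_const, smul_eq_mul] at hle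
      have hYY : ((Finset.range G).filter fun x => x ∈ Y).card ≤ L := by
        refine (Finset.card_le_card fun x hx => (Finset.mem_filter.1 hx).2).trans (by omega)
      have hG : G * (J * L * G ^ (J - 1)) = J * L * G ^ J := by
        cases J with
        | zero => simp
        | succ J => simp [pow_succ]; ring
      rw [hG] at hle
      have h2 := Nat.mul_le_mul_right (G ^ J) hYY
      have h3 : (J + 1) * L * G ^ (J + 1 - 1) = J * L * G ^ J + L * G ^ J := by
        simp only [Nat.add_sub_cancel]; ring
      omega
    obtain ⟨Y', hY'Y, hY'⟩ := Finset.exists_subset_card_eq hY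
    have hex : ∀ x : ℕ, ∃ T : Finset ι, ∃ φ : ι → MvPolynomial σ ℝ, x ∈ Y' → T ⊆ cls x ∧
        T.card = L ^ J ∧ (∀ i ∈ T, (φ i).totalDegree ≤ J * L) ∧
          ∀ i ∈ T, ∀ i' ∈ T, φ i ∈ P i' ↔ i ≠ i' := by
      intro x
      by_cases hx : x ∈ Y'
      · obtain ⟨T, hT, hTc, φ, hφ⟩ := ih (fun j => lab (j + 1)) (fun j => form (j + 1)) (cls x)
          (fun i hi => hP i (hclsB x hi))
          (fun j hj i hi => hlab _ (by omega) i (hclsB x hi))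
          (fun i hi i' hi' h => hinj i (hclsB x hi) i' (hclsB x hi') (hagree i hi i' hi' h))
          (fun j i => hdeg _ i)
          (fun j hj i hi i' hi' h => hform _ (by omega) i (hclsB x hi) i' (hclsB x hi')
            (hagree i hi i' hi' h))
          (Finset.mem_filter.1 (hY'Y hx)).2
        exact ⟨T, φ, fun _ => ⟨hT, hTc, hφ⟩⟩
      · exact ⟨∅, 0, fun h => absurd h hx⟩
    choose T φ hTφ using hex
    have hne : ∀ x ∈ Y', ∃ i, i ∈ cls x := fun x hx =>
      Finset.card_pos.1 (lt_of_le_of_lt (Nat.zero_le _) (Finset.mem_filter.1 (hY'Y hx)).2)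
    have hrep : ∃ rep : ℕ → MvPolynomial σ ℝ, ∀ x ∈ Y', (rep x).totalDegree ≤ 1 ∧
        ∀ i ∈ B, rep x ∈ P i ↔ lab 0 i = x := by
      have : ∀ x, ∃ r : MvPolynomial σ ℝ, x ∈ Y' → r.totalDegree ≤ 1 ∧
          ∀ i ∈ B, r ∈ P i ↔ lab 0 i = x := by
        intro x
        by_cases hx : x ∈ Y'
        · obtain ⟨i', hi'⟩ := hne x hx
          refine ⟨form 0 i', fun _ => ⟨hdeg 0 i', fun i hi => ?_⟩⟩
          rw [hform 0 (by omega) i hi i' (hclsB x hi') (by simp), (hcls.1 hi').2]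
        · exact ⟨0, fun h => absurd h hx⟩
      choose rep hrep using this
      exact ⟨rep, hrep⟩
    obtain ⟨rep, hrep⟩ := hrep
    have hT0 : ∀ x ∈ Y', ∀ i ∈ T x, i ∈ B ∧ lab 0 i = x := fun x hx i hi =>
      hcls.1 ((hTφ x hx).1 hi)
    -- The polynomial of i is its polynomial inside its own class times one linear form for each of
    -- the other chosen classes, adding at most L to the degree.
    refine ⟨Y'.biUnion T, ?_, ?_,
      fun i => (∏ x ∈ Y'.erase (lab 0 i), rep x) * φ (lab 0 i) i, ?_, ?_⟩
    · intro i hi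
      obtain ⟨x, hx, hix⟩ := Finset.mem_biUnion.1 hi
      exact (hT0 x hx i hix).1
    · rw [Finset.card_biUnion, Finset.sum_congr rfl fun x hx => (hTφ x hx).2.1, Finset.sum_const,
        hY', smul_eq_mul, pow_succ, mul_comm]
      intro x hx y hy hxy
      refine Finset.disjoint_left.2 fun i hix hiy => ?_
      exact hxy ((hT0 x hx i hix).2.symm.trans (hT0 y hy i hiy).2)
    · intro i hi
      obtain ⟨x, hx, hix⟩ := Finset.mem_biUnion.1 hi
      have hl := (hT0 x hx i hix).2
      simp only [hl]
      have h1 : (∏ y ∈ Y'.erase x, rep y).totalDegree ≤ L := by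
        refine (totalDegree_finsetProd _ _).trans ?_
        calc ∑ y ∈ Y'.erase x, (rep y).totalDegree ≤ ∑ _y ∈ Y'.erase x, 1 :=
              Finset.sum_le_sum fun y hy => (hrep y (Finset.mem_of_mem_erase hy)).1
          _ ≤ L := by
              rw [Finset.sum_const, smul_eq_mul, mul_one, ← hY']
              exact Finset.card_le_card (Finset.erase_subset _ _)
      have h2 := (hTφ x hx).2.2.1 i hix
      have h3 : (J + 1) * L = L + J * L := by ring
      rw [h3]
      exact (totalDegree_mul _ _).trans (Nat.add_le_add h1 h2)
    · intro i hi i' hi'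
      obtain ⟨x, hx, hix⟩ := Finset.mem_biUnion.1 hi
      obtain ⟨x', hx', hix'⟩ := Finset.mem_biUnion.1 hi'
      obtain ⟨hiB, hl⟩ := hT0 x hx i hix
      obtain ⟨hiB', hl'⟩ := hT0 x' hx' i' hix'
      have hPi' := hP i' hiB'
      simp only [hl]
      by_cases hxx : x = x'
      · subst hxx
        rw [← (hTφ x hx).2.2.2 i hix i' hix']
        refine ⟨fun h => (hPi'.mem_or_mem h).resolve_left fun h0 => ?_, fun h =>
          Ideal.mul_mem_left _ _ h⟩
        obtain ⟨y, hy, hyP⟩ := hPi'.prod_mem_iff.1 h0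
        rw [Finset.mem_erase] at hy
        rw [(hrep y hy.2).2 i' hiB', hl'] at hyP
        exact hy.1 hyP.symm
      · refine ⟨fun _ h => hxx (by rw [← hl, ← hl', h]), fun _ => Ideal.mul_mem_right _ _ ?_⟩
        refine hPi'.prod_mem_iff.2 ⟨x', Finset.mem_erase.2 ⟨fun h => hxx h.symm, hx'⟩, ?_⟩
        have hmem := (hrep x' hx').2 i' hiB'
        rwa [hmem]

/-- Averaging over all subsets `R`: each `i` has a few own elements and a few forbidden ones; some `R`
contains the own elements and avoids the forbidden ones for a fixed proportion of the `i`. -/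
theorem exists_subset_separating {X ι : Type} [Fintype X] [DecidableEq X] (B : Finset ι)
    (own full : ι → Finset X) (s : ℕ) (hsub : ∀ i ∈ B, own i ⊆ full i)
    (hs : ∀ i ∈ B, (full i).card ≤ s) :
    ∃ R : Finset X, ∃ B' ⊆ B, B.card ≤ 2 ^ s * B'.card ∧
      ∀ i ∈ B', own i ⊆ R ∧ ∀ x ∈ R, x ∈ full i → x ∈ own i := by
  classical
  let keep : Finset X → Finset ι := fun R => B.filter fun i => own i ⊆ R ∧
    R ⊆ (full i \ own i)ᶜ
  by_contra hcon
  push Not at hcon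
  have hlt : ∀ R, 2 ^ s * (keep R).card < B.card := by
    intro R
    by_contra hge
    obtain ⟨i, hi, h1⟩ := hcon R (keep R) (Finset.filter_subset _ _) (not_lt.1 hge)
    have hi' := (Finset.mem_filter.1 hi).2
    obtain ⟨x, hxR, hxf, hxo⟩ := h1 hi'.1
    have := hi'.2 hxR
    simp [hxf, hxo] at this
  have hdc : ∑ R : Finset X, (keep R).card =
      ∑ i ∈ B, (Finset.Icc (own i) (full i \ own i)ᶜ).card := by
    have := Finset.sum_card_bipartiteAbove_eq_sum_card_bipartiteBelow (s := Finset.univ) (t := B)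
      (fun (R : Finset X) i => own i ⊆ R ∧ R ⊆ (full i \ own i)ᶜ)
    refine this.trans (Finset.sum_congr rfl fun i _ => ?_)
    congr 1
    ext R
    simp [Finset.bipartiteBelow]
  -- The admissible R for i have `full i` prescribed and are free elsewhere, a proportion of
  -- 2^(-|full i|) ≥ 2^(-s).
  have hcount : ∀ i ∈ B, 2 ^ Fintype.card X ≤
      2 ^ s * (Finset.Icc (own i) (full i \ own i)ᶜ).card := by
    intro i hi
    have hle : own i ⊆ (full i \ own i)ᶜ := fun x hx => by simp [hx]
    rw [Finset.card_Icc_finset hle, ← pow_add, Finset.card_compl,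
      Finset.card_sdiff_of_subset (hsub i hi)]
    refine Nat.pow_le_pow_right (by norm_num) ?_
    have h1 := hs i hi
    have h2 := Finset.card_le_card (hsub i hi)
    have h3 := Finset.card_le_univ (full i)
    omega
  have h1 : ∑ R : Finset X, 2 ^ s * (keep R).card < ∑ _R : Finset X, B.card :=
    Finset.sum_lt_sum_of_nonempty Finset.univ_nonempty fun R _ => hlt R
  have h2 : ∑ _i ∈ B, 2 ^ Fintype.card X ≤ ∑ R : Finset X, 2 ^ s * (keep R).card := by
    rw [← Finset.mul_sum, hdc, Finset.mul_sum]
    exact Finset.sum_le_sum hcount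
  simp only [Finset.sum_const, smul_eq_mul, Finset.card_univ, Fintype.card_finset] at h1 h2
  rw [mul_comm] at h2
  omega

end FlatIncidence

end

noncomputable section

open MvPolynomial

namespace FlatIncidence

/-! ### The linear forms that cut out the flats -/

/-- Inverting the Vandermonde matrix expresses each `t k` through the given combinations. -/
theorem mem_of_vandermonde_mem {M : Type} [AddCommGroup M] [Module ℝ M] (E : Submodule ℝ M) {N : ℕ}
    (s : Fin N → ℝ) (hs : Function.Injective s) (t : Fin N → M)
    (h : ∀ i, ∑ k : Fin N, s i ^ (k : ℕ) • t k ∈ E) (k : Fin N) : t k ∈ E := by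
  have hdet : IsUnit (Matrix.vandermonde s).det :=
    isUnit_iff_ne_zero.2 (Matrix.det_vandermonde_ne_zero_iff.2 hs)
  have hinv := Matrix.nonsing_inv_mul _ hdet
  have : t k = ∑ i, (Matrix.vandermonde s)⁻¹ k i • ∑ l : Fin N, s i ^ (l : ℕ) • t l := by
    simp_rw [Finset.smul_sum, smul_smul]
    rw [Finset.sum_comm]
    have h1 : ∀ l : Fin N, ∑ i, ((Matrix.vandermonde s)⁻¹ k i * s i ^ (l : ℕ)) • t l =
        (1 : Matrix (Fin N) (Fin N) ℝ) k l • t l := fun l => by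
      rw [← Finset.sum_smul, ← hinv, Matrix.mul_apply]
      rfl
    simp_rw [h1, Matrix.one_apply]
    simp
  rw [this]
  exact Submodule.sum_mem _ fun i _ => Submodule.smul_mem _ _ (h i)

/-- The affine form `∑ s ^ k t_k - ∑ A_j z_j - b` in the coordinates `(z, t)` of `ℝ^a × ℝ^(e+1)`. -/
def slopeForm {a : ℕ} (e : ℕ) (A : Fin a → ℝ) (b s : ℝ) : MvPolynomial (Fin (a + (e + 1))) ℝ :=
  ∑ k : Fin (e + 1), C (s ^ (k : ℕ)) * X (Fin.natAdd a k) -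
    ∑ j, C (A j) * X (Fin.castAdd (e + 1) j) - C b

/-- The linear form `∑ l ^ k t_{k+1}` in the coordinates `(z, t)` of `ℝ^a × ℝ^(e+1)`. -/
def fiberForm (a e : ℕ) (l : ℝ) : MvPolynomial (Fin (a + (e + 1))) ℝ :=
  ∑ k : Fin e, C (l ^ (k : ℕ)) * X (Fin.natAdd a k.succ)

theorem eval_slopeForm {a e : ℕ} (A : Fin a → ℝ) (b s : ℝ) (x : Fin (a + (e + 1)) → ℝ) :
    eval x (slopeForm e A b s) = ∑ k : Fin (e + 1), s ^ (k : ℕ) * x (Fin.natAdd a k) -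
      ∑ j, A j * x (Fin.castAdd (e + 1) j) - b := by
  simp [slopeForm]

theorem eval_fiberForm {a e : ℕ} (l : ℝ) (x : Fin (a + (e + 1)) → ℝ) :
    eval x (fiberForm a e l) = ∑ k : Fin e, l ^ (k : ℕ) * x (Fin.natAdd a k.succ) := by
  simp [fiberForm]

theorem totalDegree_C_mul_X_le {σ : Type} (r : ℝ) (j : σ) :
    (C r * X j : MvPolynomial σ ℝ).totalDegree ≤ 1 :=
  (totalDegree_mul _ _).trans (by simp)

theorem totalDegree_slopeForm_le {a e : ℕ} (A : Fin a → ℝ) (b s : ℝ) :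
    (slopeForm e A b s).totalDegree ≤ 1 := by
  refine (totalDegree_sub_C_le _ _).trans ((totalDegree_sub _ _).trans (max_le ?_ ?_)) <;>
  exact (totalDegree_finsetSum _ _).trans (Finset.sup_le fun _ _ => totalDegree_C_mul_X_le _ _)

theorem totalDegree_fiberForm_le {a e : ℕ} (l : ℝ) : (fiberForm a e l).totalDegree ≤ 1 :=
  (totalDegree_finsetSum _ _).trans (Finset.sup_le fun _ _ => totalDegree_C_mul_X_le _ _)

/-! ### Linear forms contained in a prime of large dimension -/

section Quotient

variable {a e : ℕ} (P : Ideal (MvPolynomial (Fin (a + (e + 1))) ℝ))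

/-- The subalgebra of the quotient by `P` generated by the first `a` coordinates. -/
def baseHom : MvPolynomial (Fin a) ℝ →ₐ[ℝ] (MvPolynomial (Fin (a + (e + 1))) ℝ ⧸ P) :=
  aeval fun j => Ideal.Quotient.mk P (X (Fin.castAdd (e + 1) j))

theorem ringKrullDim_le_of_mem_range
    (h : ∀ k : Fin (e + 1), Ideal.Quotient.mk P (X (Fin.natAdd a k)) ∈ (baseHom P).range) :
    ringKrullDim (MvPolynomial (Fin (a + (e + 1))) ℝ ⧸ P) ≤ (a : ℕ∞) := by
  have hsurj : Function.Surjective (baseHom P) := by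
    rw [← AlgHom.range_eq_top, eq_top_iff]
    have h1 := congrArg (Subalgebra.map (Ideal.Quotient.mkₐ ℝ P))
      (MvPolynomial.adjoin_range_X (R := ℝ) (σ := Fin (a + (e + 1))))
    rw [AlgHom.map_adjoin, Algebra.map_top, (AlgHom.range_eq_top _).2
      (Ideal.Quotient.mkₐ_surjective ℝ P), ← Set.range_comp] at h1
    rw [← h1, Algebra.adjoin_le_iff]
    rintro _ ⟨j, rfl⟩
    induction j using Fin.addCases with
    | left j => exact ⟨X j, by simp [baseHom]⟩
    | right k => exact h k
  have := ringKrullDim_le_of_surjective (baseHom P).toRingHom hsurj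
  rw [MvPolynomial.ringKrullDim_of_isNoetherianRing, ringKrullDim_eq_zero_of_field, zero_add,
    Nat.card_fin] at this
  exact this

theorem mk_slopeForm_add (A : Fin a → ℝ) (b s : ℝ) (h : slopeForm e A b s ∈ P) :
    ∑ k : Fin (e + 1), s ^ (k : ℕ) • Ideal.Quotient.mk P (X (Fin.natAdd a k)) ∈
      Subalgebra.toSubmodule (baseHom P).range := by
  rw [slopeForm, sub_sub, ← Ideal.Quotient.eq] at h
  refine ⟨∑ j, C (A j) * X j + C b, ?_⟩
  have h1 : ∑ k : Fin (e + 1), s ^ (k : ℕ) • Ideal.Quotient.mk P (X (Fin.natAdd a k)) =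
      Ideal.Quotient.mkₐ ℝ P (∑ k : Fin (e + 1), C (s ^ (k : ℕ)) * X (Fin.natAdd a k)) := by
    rw [map_sum]
    refine Finset.sum_congr rfl fun k _ => ?_
    rw [← smul_eq_C_mul, map_smul]
    rfl
  rw [h1, Ideal.Quotient.mkₐ_eq_mk, h, ← Ideal.Quotient.mkₐ_eq_mk ℝ]
  simp only [← smul_eq_C_mul, map_add, map_sum, map_smul]
  simp only [AlgHom.toRingHom_eq_coe, RingHom.coe_coe, map_smul]
  congr 1
  · exact Finset.sum_congr rfl fun j _ => by simp [baseHom]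
  · rw [← algebraMap_eq, AlgHom.commutes, ← algebraMap_eq, AlgHom.commutes]

/-- With e + 1 slope forms in P, Vandermonde makes every t-coordinate a polynomial in z modulo P, so
the quotient has dimension at most a. -/
theorem card_slopeForm_mem_le {ι : Type} (A : ι → Fin a → ℝ) (b s : ι → ℝ)
    (hs : Function.Injective s) (hdim : ((a + 1 : ℕ) : WithBot ℕ∞) ≤
      ringKrullDim (MvPolynomial (Fin (a + (e + 1))) ℝ ⧸ P)) (T : Finset ι)
    (hT : ∀ i ∈ T, slopeForm e (A i) (b i) (s i) ∈ P) : T.card ≤ e := by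
  by_contra hlt
  obtain ⟨v⟩ : Nonempty (Fin (e + 1) ↪ T) :=
    Function.Embedding.nonempty_of_card_le (by simpa using hlt)
  have hmem := mem_of_vandermonde_mem (Subalgebra.toSubmodule (baseHom P).range)
    (fun i => s (v i)) (fun i j h => v.injective (Subtype.ext (hs h)))
    (fun k => Ideal.Quotient.mk P (X (Fin.natAdd a k)))
    (fun i => mk_slopeForm_add P _ _ _ (hT _ (v i).2))
  have := hdim.trans (ringKrullDim_le_of_mem_range P hmem)
  have h2 : a + 1 ≤ a := by exact_mod_cast this
  omega

/-- Already e fiber forms make t_1, …, t_e vanish modulo P. The slope form, in which t_0 has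
coefficient 1, then expresses t_0 through z, and the dimension drops to at most a. -/
theorem card_fiberForm_mem_le {ι : Type} (l : ι → ℝ) (hl : Function.Injective l) (A : Fin a → ℝ)
    (b s : ℝ) (hP : slopeForm e A b s ∈ P) (hdim : ((a + 1 : ℕ) : WithBot ℕ∞) ≤
      ringKrullDim (MvPolynomial (Fin (a + (e + 1))) ℝ ⧸ P)) (T : Finset ι)
    (hT : ∀ i ∈ T, fiberForm a e (l i) ∈ P) : T.card ≤ e := by
  by_contra hlt
  obtain ⟨v⟩ : Nonempty (Fin e ↪ T) :=
    Function.Embedding.nonempty_of_card_le (by simpa using (not_le.1 hlt).le)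
  have hmem := mem_of_vandermonde_mem (Subalgebra.toSubmodule (baseHom P).range)
    (fun i => l (v i)) (fun i j h => v.injective (Subtype.ext (hl h)))
    (fun k : Fin e => Ideal.Quotient.mk P (X (Fin.natAdd a k.succ)))
    (fun i => by
      have h0 := (Ideal.Quotient.eq_zero_iff_mem).2 (hT _ (v i).2)
      rw [fiberForm, ← Ideal.Quotient.mkₐ_eq_mk ℝ, map_sum] at h0
      simp only [← smul_eq_C_mul, map_smul] at h0
      simp only [Ideal.Quotient.mkₐ_eq_mk] at h0
      rw [h0]
      exact Submodule.zero_mem _)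
  have hall : ∀ k : Fin (e + 1), Ideal.Quotient.mk P (X (Fin.natAdd a k)) ∈
      Subalgebra.toSubmodule (baseHom P).range := by
    intro k
    refine Fin.cases ?_ hmem k
    have h1 := mk_slopeForm_add P A b s hP
    rw [Fin.sum_univ_succ] at h1
    have h2 : ∑ k : Fin e, s ^ ((k.succ : Fin (e + 1)) : ℕ) •
        Ideal.Quotient.mk P (X (Fin.natAdd a k.succ)) ∈
        Subalgebra.toSubmodule (baseHom P).range :=
      Submodule.sum_mem _ fun k _ => Submodule.smul_mem _ _ (hmem k)
    have h3 := (Submodule.add_mem_iff_left _ h2).1 h1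
    simpa using h3
  have := hdim.trans (ringKrullDim_le_of_mem_range P hall)
  have h2 : a + 1 ≤ a := by exact_mod_cast this
  omega

end Quotient

end FlatIncidence

end

noncomputable section

open MvPolynomial

namespace FlatIncidence

/-! ### Few flats meet a variety in too large a dimension -/

/-- A branching number that exceeds what the Hilbert function of a variety of degree at most `c` in
`ℝ^d` allows. -/
def branching (d c : ℕ) : ℕ := 2 ^ d * (2 * c + 1) ^ d * (2 * d + 1) ^ d + 1

/-- The right side has at least δ + 1 factors L against the left side's δ, and `branching` exceeds
the left side's constant. -/
theorem hilbert_lt_branching {d c g δ k' : ℕ} (hδ : δ ≤ d) (hg : g + 1 ≤ d) (hk' : k' ≤ d)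
    (hlt : δ < g + 1 + k') :
    2 ^ d * ((2 * c + 1) ^ d *
      ((g + 1) * branching d c + k' * branching d c + 1) ^ δ) <
    branching d c ^ (g + 1) * (branching d c + 1) ^ k' := by
  set L := branching d c with hL
  have hL1 : 1 ≤ L := by simp [hL, branching]
  have h1 : (g + 1) * L + k' * L + 1 ≤ (2 * d + 1) * L := by nlinarith
  calc 2 ^ d * ((2 * c + 1) ^ d * ((g + 1) * L + k' * L + 1) ^ δ)
      ≤ 2 ^ d * ((2 * c + 1) ^ d * ((2 * d + 1) * L) ^ δ) := by gcongr
    _ = 2 ^ d * (2 * c + 1) ^ d * (2 * d + 1) ^ δ * L ^ δ := by rw [mul_pow]; ring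
    _ ≤ 2 ^ d * (2 * c + 1) ^ d * (2 * d + 1) ^ d * L ^ δ := by gcongr; omega
    _ < L * L ^ δ := by
        refine Nat.mul_lt_mul_of_pos_right ?_ (by positivity)
        rw [hL, branching]
        omega
    _ = L ^ (δ + 1) := by ring
    _ ≤ L ^ (g + 1 + k') := Nat.pow_le_pow_right hL1 hlt
    _ = L ^ (g + 1) * L ^ k' := pow_add _ _ _
    _ ≤ L ^ (g + 1) * (L + 1) ^ k' := by gcongr; omega

theorem mod_pow_eq_of_digits_eq (G i i' : ℕ) : ∀ J : ℕ,
    (∀ j < J, i / G ^ j % G = i' / G ^ j % G) → i % G ^ J = i' % G ^ J := by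
  intro J
  induction J with
  | zero => simp [Nat.mod_one]
  | succ J ih =>
    intro h
    rw [Nat.mod_pow_succ, Nat.mod_pow_succ, ih fun j hj => h j (by omega), h J (by omega)]

/-- Too many such flats would force a Hilbert function on U larger than its dimension allows. The
tree has depth g + 1: the first g levels are separated by fiber forms, the last by slope forms. A
node has at most G children, which is what limits the flats to order G^g instead of n. -/
theorem card_large_intersection_le {a e g G n c δ k' : ℕ} (hge : g ≤ e) (hn : n ≤ G ^ (g + 1))
    (A : Fin n → Fin a → ℝ) (b : Fin n → ℝ) (v : Fin n → Set (Fin (a + (e + 1)) → ℝ))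
    (hslope : ∀ i, ∀ x ∈ v i, eval x (slopeForm e (A i) (b i) (i : ℕ)) = 0)
    (hfiber : ∀ i, ∀ x ∈ v i, ∀ j < g,
      eval x (fiberForm a e ((j * G + i / G ^ j % G : ℕ) : ℝ)) = 0)
    {U : Set (Fin (a + (e + 1)) → ℝ)} (hU : IsVarietyOfDegreeLE c U) (hdim : algDim U ≤ (δ : ℕ∞))
    (hδ : δ ≤ a + (e + 1)) (hk : a + 1 ≤ k') (hk' : k' ≤ a + (e + 1)) (hlt : δ < g + 1 + k') :
    {i : Fin n | algDim (v i ∩ U) = (k' : WithBot ℕ∞)}.ncard ≤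
      4 ^ (a + (e + 1)) * ((g + 1) * branching (a + (e + 1)) c * G ^ g) := by
  classical
  set L := branching (a + (e + 1)) c
  set B : Finset (Fin n) := Finset.univ.filter fun i => algDim (v i ∩ U) = (k' : WithBot ℕ∞)
  have hB : {i : Fin n | algDim (v i ∩ U) = (k' : WithBot ℕ∞)}.ncard = B.card := by
    rw [← Set.ncard_coe_finset]
    simp [B]
  rw [hB]
  have hex : ∀ i : Fin n, ∃ P : Ideal (MvPolynomial (Fin (a + (e + 1))) ℝ), i ∈ B → P.IsPrime ∧
      vanishingIdeal ℝ (v i ∩ U) ≤ P ∧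
      (k' : WithBot ℕ∞) ≤ ringKrullDim (MvPolynomial (Fin (a + (e + 1))) ℝ ⧸ P) := by
    intro i
    by_cases hi : i ∈ B
    · have h1 : algDim (v i ∩ U) = (k' : WithBot ℕ∞) := (Finset.mem_filter.1 hi).2
      obtain ⟨P, hP⟩ := exists_isPrime_le_ringKrullDim _ h1.ge
      exact ⟨P, fun _ => hP⟩
    · exact ⟨⊥, fun h => absurd h hi⟩
  choose P hP using hex
  have hdimP : ∀ i ∈ B, ((a + 1 : ℕ) : WithBot ℕ∞) ≤
      ringKrullDim (MvPolynomial (Fin (a + (e + 1))) ℝ ⧸ P i) := fun i hi =>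
    le_trans (by exact_mod_cast hk) (hP i hi).2.2
  have hslopeP : ∀ i ∈ B, slopeForm e (A i) (b i) (i : ℕ) ∈ P i := fun i hi =>
    (hP i hi).2.1 (mem_vanishingIdeal_iff_eval.2 fun x hx => hslope i x hx.1)
  have hfiberP : ∀ i ∈ B, ∀ j < g,
      fiberForm a e ((j * G + i / G ^ j % G : ℕ) : ℝ) ∈ P i := fun i hi j hj =>
    (hP i hi).2.1 (mem_vanishingIdeal_iff_eval.2 fun x hx => hfiber i x hx.1 j hj)
  by_cases hn0 : n = 0
  · subst hn0
    simp [Finset.eq_empty_of_isEmpty B]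
  have hG : 0 < G := by
    rcases Nat.eq_zero_or_pos G with h | h
    · rw [h] at hn; simp at hn; exact absurd hn hn0
    · exact h
  let dig : ℕ → Fin n → Fin G := fun j i => ⟨i / G ^ j % G, Nat.mod_lt _ hG⟩
  -- The forms of all flats together. The labels jG + digit are distinct across levels as well, so
  -- the Vandermonde count applies to all fiber forms at once.
  let frm : (Fin g × Fin G) ⊕ Fin n → MvPolynomial (Fin (a + (e + 1))) ℝ := fun x => match x with
    | Sum.inl y => fiberForm a e ((y.1 * G + y.2 : ℕ) : ℝ)
    | Sum.inr i => slopeForm e (A i) (b i) (i : ℕ)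
  let own : Fin n → Finset ((Fin g × Fin G) ⊕ Fin n) := fun i =>
    (Finset.univ.image fun j : Fin g => Sum.inl (j, dig j i)) ∪ {Sum.inr i}
  let full : Fin n → Finset ((Fin g × Fin G) ⊕ Fin n) := fun i =>
    Finset.univ.filter fun x => frm x ∈ P i
  have hfull : ∀ {i x}, x ∈ full i ↔ frm x ∈ P i := by simp [full]
  have hsub : ∀ i ∈ B, own i ⊆ full i := by
    intro i hi x hx
    rw [hfull]
    simp only [own, Finset.mem_union, Finset.mem_image, Finset.mem_univ, true_and,
      Finset.mem_singleton] at hx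
    rcases hx with ⟨j, rfl⟩ | rfl
    · exact hfiberP i hi j j.2
    · exact hslopeP i hi
  have hcard : ∀ i ∈ B, (full i).card ≤ 2 * (a + (e + 1)) := by
    intro i hi
    rw [← Finset.card_toLeft_add_card_toRight]
    have h1 : (full i).toLeft.card ≤ e :=
      card_fiberForm_mem_le (P i) (fun y : Fin g × Fin G => ((y.1 * G + y.2 : ℕ) : ℝ))
        (by
          rintro ⟨j, x⟩ ⟨j', x'⟩ h
          have h' : (j : ℕ) * G + x = j' * G + x' := Nat.cast_injective (R := ℝ) h
          have hx := x.2
          have hx' := x'.2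
          have hjj : (j : ℕ) = j' := by
            have h2 := congrArg (· / G) h'
            simpa [Nat.add_div_of_dvd_right, Nat.mul_div_cancel _ hG, Nat.div_eq_of_lt hx,
              Nat.div_eq_of_lt hx'] using h2
          rw [hjj] at h'
          exact Prod.ext (Fin.ext hjj) (Fin.ext (by simpa using h')))
        (A i) (b i) _ (hslopeP i hi) (hdimP i hi) _
        (fun y hy => hfull.1 (Finset.mem_toLeft.1 hy))
    have h2 : (full i).toRight.card ≤ e :=
      card_slopeForm_mem_le (P i) A b (fun i => ((i : ℕ) : ℝ))
        (fun i j h => Fin.ext (Nat.cast_injective (R := ℝ) h)) (hdimP i hi) _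
        (fun y hy => hfull.1 (Finset.mem_toRight.1 hy))
    omega
  -- On B' no prime contains a form from R other than its own; a proportion 4^(-d) of the flats
  -- survives.
  obtain ⟨R, B', hB'B, hB', hR⟩ := exists_subset_separating B own full (2 * (a + (e + 1))) hsub hcard
  rw [pow_mul, show 2 ^ 2 = 4 by norm_num] at hB'
  refine hB'.trans (Nat.mul_le_mul_left _ ?_)
  by_contra hbig
  have hownR : ∀ i ∈ B', ∀ j : Fin g, Sum.inl (j, dig j i) ∈ R := fun i hi j =>
    (hR i hi).1 (by simp [own])
  have hownR' : ∀ i ∈ B', Sum.inr i ∈ R := fun i hi => (hR i hi).1 (by simp [own])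
  have hinjg : ∀ i i' : Fin n, (∀ j < g + 1, (dig j i : ℕ) = dig j i') → i = i' := by
    intro i i' h
    have := mod_pow_eq_of_digits_eq G i i' (g + 1) h
    rw [Nat.mod_eq_of_lt (i.2.trans_le hn), Nat.mod_eq_of_lt (i'.2.trans_le hn)] at this
    exact Fin.ext this
  obtain ⟨T, hTB, hTc, φ, hφd, hφ⟩ := exists_separated_subfamily P G L (g + 1)
    (fun j i => dig j i)
    (fun j i => if j < g then fiberForm a e ((j * G + i / G ^ j % G : ℕ) : ℝ)
      else slopeForm e (A i) (b i) (i : ℕ)) B'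
    (fun i hi => (hP i (hB'B hi)).1)
    (fun j _ i _ => (dig j i).2)
    (fun i _ i' _ h => hinjg i i' h)
    (fun j i => by
      split_ifs
      · exact totalDegree_fiberForm_le _
      · exact totalDegree_slopeForm_le _ _ _)
    (by
      intro j hj i hi i' hi' hlow
      split_ifs with hjg
      · constructor
        · intro hmem
          have h1 : (Sum.inl (⟨j, hjg⟩, dig j i') : (Fin g × Fin G) ⊕ Fin n) ∈ full i :=
            hfull.2 hmem
          have h2 := (hR i hi).2 _ (hownR i' hi' ⟨j, hjg⟩) h1
          simp only [own, Finset.mem_union, Finset.mem_image, Finset.mem_univ, true_and,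
            Finset.mem_singleton, Sum.inl.injEq, Prod.mk.injEq, reduceCtorEq, or_false] at h2
          obtain ⟨j', hj', h3⟩ := h2
          rw [hj'] at h3
          exact congrArg Fin.val h3
        · intro heq
          have heq' : (i : ℕ) / G ^ j % G = i' / G ^ j % G := heq
          rw [← heq']
          exact hfiberP i (hB'B hi) j hjg
      -- At the last level the slope form singles out one flat; given the earlier digits, equality
      -- of the last digit says the same.
      · have hjg' : j = g := by omega
        subst hjg'
        constructor
        · intro hmem
          have h2 := (hR i hi).2 _ (hownR' i' hi') (hfull.2 hmem)
          simp only [own, Finset.mem_union, Finset.mem_image, Finset.mem_univ, true_and,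
            Finset.mem_singleton, Sum.inr.injEq, reduceCtorEq, exists_false, false_or] at h2
          rw [h2]
        · intro heq
          have hii : i = i' := hinjg i i' fun j' hj' => by
            rcases Nat.lt_succ_iff_lt_or_eq.1 hj' with h | h
            · exact hlow j' h
            · rw [h]; exact heq
          rw [← hii]
          exact hslopeP i (hB'B hi))
    (by simpa using hbig)
  have hlow := card_mul_le_hilbertFn (vanishingIdeal ℝ U) T P
    (fun i hi => (hP i (hB'B (hTB hi))).1)
    (fun i hi => (vanishingIdeal_anti_mono Set.inter_subset_right).trans
      (hP i (hB'B (hTB hi))).2.1)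
    (fun i hi => (hP i (hB'B (hTB hi))).2.2) φ hφd hφ L
  have hup := hilbertFn_variety_le hU hdim ((g + 1) * L + k' * L)
  have hcontra := hilbert_lt_branching (c := c) hδ (show g + 1 ≤ a + (e + 1) by omega) hk' hlt
  rw [hTc] at hlow
  exact absurd (hlow.trans hup) (not_le.2 hcontra)

end FlatIncidence

end

noncomputable section

open MvPolynomial

namespace FlatIncidence

/-! ### The flats -/

theorem finrank_ker_of_surjective {N m : ℕ} (f : (Fin N → ℝ) →ₗ[ℝ] (Fin m → ℝ))
    (hf : Function.Surjective f) : Module.finrank ℝ (LinearMap.ker f) + m = N := by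
  have h := f.finrank_range_add_finrank_ker
  rw [LinearMap.range_eq_top.2 hf, finrank_top] at h
  simp only [Module.finrank_fin_fun] at h
  omega

/-- The point of `ℝ^a × ℝ^(e+1)` with coordinates `(z, w, 0, …, 0)`. -/
def framePoint {a : ℕ} (e : ℕ) (z : Fin a → ℝ) (w : ℝ) : Fin (a + (e + 1)) → ℝ :=
  Fin.append z (Fin.cons w 0)

theorem framePoint_castAdd {a e : ℕ} (z : Fin a → ℝ) (w : ℝ) (j : Fin a) :
    framePoint e z w (Fin.castAdd (e + 1) j) = z j := by simp [framePoint]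

theorem framePoint_natAdd_zero {a e : ℕ} (z : Fin a → ℝ) (w : ℝ) :
    framePoint e z w (Fin.natAdd a 0) = w := by simp [framePoint]

theorem framePoint_natAdd_succ {a e : ℕ} (z : Fin a → ℝ) (w : ℝ) (k : Fin e) :
    framePoint e z w (Fin.natAdd a k.succ) = 0 := by simp [framePoint]

theorem eval_slopeForm_framePoint {a e : ℕ} (A : Fin a → ℝ) (b s : ℝ) (z : Fin a → ℝ) (w : ℝ) :
    eval (framePoint e z w) (slopeForm e A b s) = w - ∑ j, A j * z j - b := by
  rw [eval_slopeForm, Fin.sum_univ_succ]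
  simp [framePoint_castAdd, framePoint_natAdd_succ, framePoint_natAdd_zero]

theorem eval_fiberForm_framePoint {a e : ℕ} (l : ℝ) (z : Fin a → ℝ) (w : ℝ) :
    eval (framePoint e z w) (fiberForm a e l) = 0 := by
  rw [eval_fiberForm]
  simp [framePoint_natAdd_succ]

/-- The linear parts of `slopeForm` and of `g` fiber forms. -/
def flatMap {a g : ℕ} (e : ℕ) (A : Fin a → ℝ) (s : ℝ) (l : Fin g → ℝ) :
    (Fin (a + (e + 1)) → ℝ) →ₗ[ℝ] (Fin (g + 1) → ℝ) :=
  LinearMap.pi (Fin.cons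
    (∑ k : Fin (e + 1), s ^ (k : ℕ) • LinearMap.proj (Fin.natAdd a k) -
      ∑ j, A j • LinearMap.proj (Fin.castAdd (e + 1) j))
    fun j => ∑ k : Fin e, l j ^ (k : ℕ) • LinearMap.proj (Fin.natAdd a k.succ))

theorem flatMap_zero {a g e : ℕ} (A : Fin a → ℝ) (s : ℝ) (l : Fin g → ℝ)
    (x : Fin (a + (e + 1)) → ℝ) : flatMap e A s l x 0 =
      ∑ k : Fin (e + 1), s ^ (k : ℕ) * x (Fin.natAdd a k) -
        ∑ j, A j * x (Fin.castAdd (e + 1) j) := by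
  simp [flatMap]

theorem flatMap_succ {a g e : ℕ} (A : Fin a → ℝ) (s : ℝ) (l : Fin g → ℝ)
    (x : Fin (a + (e + 1)) → ℝ) (j : Fin g) : flatMap e A s l x j.succ =
      ∑ k : Fin e, l j ^ (k : ℕ) * x (Fin.natAdd a k.succ) := by
  simp [flatMap]

/-- Lagrange interpolation at the distinct labels prescribes the g fiber values, with degree below g
≤ e; t_0 is then free to adjust the slope value. -/
theorem flatMap_surjective {a g e : ℕ} (hge : g ≤ e) (A : Fin a → ℝ) (s : ℝ) (l : Fin g → ℝ)
    (hl : Function.Injective l) : Function.Surjective (flatMap e A s l) := by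
  intro c
  let q : Polynomial ℝ := Lagrange.interpolate Finset.univ l fun j => c j.succ
  have hdeg : q = 0 ∨ q.natDegree < e := by
    by_cases h0 : q = 0
    · exact Or.inl h0
    · right
      have := Lagrange.degree_interpolate_lt (s := Finset.univ) (v := l) (fun j => c j.succ)
        hl.injOn
      rw [Polynomial.degree_eq_natDegree h0] at this
      have h2 : q.natDegree < g := by simpa using this
      omega
  have heval : ∀ j, ∑ k : Fin e, l j ^ (k : ℕ) * q.coeff k = c j.succ := by
    intro j
    have h1 : q.eval (l j) = c j.succ :=
      Lagrange.eval_interpolate_at_node _ hl.injOn (Finset.mem_univ j)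
    rw [← h1]
    rcases hdeg with h0 | h0
    · simp [h0]
    · rw [Polynomial.eval_eq_sum_range' h0, Finset.sum_range]
      exact Finset.sum_congr rfl fun k _ => mul_comm _ _
  refine ⟨Fin.append 0 (Fin.cons (c 0 - ∑ k : Fin e, s ^ ((k : ℕ) + 1) * q.coeff k)
    fun k => q.coeff k), ?_⟩
  funext j
  refine Fin.cases ?_ (fun j => ?_) j
  · rw [flatMap_zero, Fin.sum_univ_succ]
    simp
  · rw [flatMap_succ, ← heval j]
    simp

/-- The flat cut out by a slope form and `g` fiber forms. -/
def flatOf {a g : ℕ} (e : ℕ) (A : Fin a → ℝ) (b s : ℝ) (l : Fin g → ℝ) :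
    AffineSubspace ℝ (Fin (a + (e + 1)) → ℝ) :=
  AffineSubspace.mk' (framePoint e 0 b) (LinearMap.ker (flatMap e A s l))

theorem mem_flatOf {a g e : ℕ} (A : Fin a → ℝ) (b s : ℝ) (l : Fin g → ℝ)
    (x : Fin (a + (e + 1)) → ℝ) : x ∈ flatOf e A b s l ↔
      eval x (slopeForm e A b s) = 0 ∧ ∀ j, eval x (fiberForm a e (l j)) = 0 := by
  have h0 := eval_slopeForm_framePoint (e := e) A b s 0 b
  have h1 := fun j => eval_fiberForm_framePoint (e := e) (l j) (0 : Fin a → ℝ) b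
  rw [eval_slopeForm] at h0
  simp only [eval_fiberForm] at h1
  rw [flatOf, AffineSubspace.mem_mk', vsub_eq_sub, LinearMap.mem_ker, map_sub, sub_eq_zero,
    funext_iff, Fin.forall_fin_succ, flatMap_zero, flatMap_zero, eval_slopeForm]
  simp only [flatMap_succ, eval_fiberForm, h1]
  refine and_congr_left fun _ => ?_
  simp only [Pi.zero_apply, mul_zero, Finset.sum_const_zero, sub_zero, sub_self] at h0
  constructor <;> intro h <;> linarith

theorem framePoint_mem_flatOf {a g e : ℕ} (A : Fin a → ℝ) (b s : ℝ) (l : Fin g → ℝ)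
    (z : Fin a → ℝ) (w : ℝ) : framePoint e z w ∈ flatOf e A b s l ↔ w = ∑ j, A j * z j + b := by
  rw [mem_flatOf, eval_slopeForm_framePoint]
  simp only [eval_fiberForm_framePoint, implies_true, and_true]
  constructor <;> intro h <;> linarith

theorem isFlat_flatOf {a r g : ℕ} (A : Fin a → ℝ) (b s : ℝ) (l : Fin g → ℝ)
    (hl : Function.Injective l) : IsFlat (a + r) (flatOf (r + g) A b s l) := by
  refine ⟨⟨_, AffineSubspace.self_mem_mk' _ _⟩, ?_⟩
  rw [flatOf, AffineSubspace.direction_mk']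
  have := finrank_ker_of_surjective _ (flatMap_surjective (Nat.le_add_left g r) A s l hl)
  omega

/-- The map `(z, t) ↦ (t_1, …, t_e)`. -/
def frameMap (a e : ℕ) : (Fin (a + (e + 1)) → ℝ) →ₗ[ℝ] (Fin e → ℝ) :=
  LinearMap.pi fun k => LinearMap.proj (Fin.natAdd a k.succ)

/-- The flat `{(z, t) : t_1 = ⋯ = t_e = 0}`. -/
def frameFlat (a e : ℕ) : AffineSubspace ℝ (Fin (a + (e + 1)) → ℝ) :=
  AffineSubspace.mk' 0 (LinearMap.ker (frameMap a e))

theorem framePoint_mem_frameFlat {a e : ℕ} (z : Fin a → ℝ) (w : ℝ) :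
    framePoint e z w ∈ frameFlat a e := by
  rw [frameFlat, AffineSubspace.mem_mk', vsub_eq_sub, sub_zero, LinearMap.mem_ker]
  funext k
  exact framePoint_natAdd_succ z w k

theorem isFlat_frameFlat (a e : ℕ) : IsFlat (a + 1) (frameFlat a e) := by
  refine ⟨⟨_, AffineSubspace.self_mem_mk' _ _⟩, ?_⟩
  rw [frameFlat, AffineSubspace.direction_mk']
  have := finrank_ker_of_surjective (frameMap a e) (fun y =>
    ⟨Fin.append 0 (Fin.cons 0 y), by funext k; simp [frameMap]⟩)
  omega

/-- On the frame the fiber forms vanish identically and the slope form becomes w - A·z - b, so a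
hyperplane of the frame remains. -/
theorem isFlat_flatOf_inf_frameFlat {a g e : ℕ} (A : Fin a → ℝ) (b s : ℝ) (l : Fin g → ℝ) :
    IsFlat a (flatOf e A b s l ⊓ frameFlat a e) := by
  have hmem : framePoint e 0 b ∈ flatOf e A b s l := AffineSubspace.self_mem_mk' _ _
  have hmem' : framePoint e 0 b ∈ frameFlat a e := framePoint_mem_frameFlat 0 b
  refine ⟨⟨_, hmem, hmem'⟩, ?_⟩
  rw [AffineSubspace.direction_inf_of_mem hmem hmem', flatOf, frameFlat,
    AffineSubspace.direction_mk', AffineSubspace.direction_mk']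
  let f : (Fin (a + (e + 1)) → ℝ) →ₗ[ℝ] (Fin (e + 1) → ℝ) := LinearMap.pi (Fin.cons
    (LinearMap.proj (Fin.natAdd a 0) - ∑ j, A j • LinearMap.proj (Fin.castAdd (e + 1) j))
    fun k => LinearMap.proj (Fin.natAdd a k.succ))
  have hf0 : ∀ x, f x 0 = x (Fin.natAdd a 0) - ∑ j, A j * x (Fin.castAdd (e + 1) j) :=
    fun x => by simp [f]
  have hfs : ∀ x (k : Fin e), f x k.succ = x (Fin.natAdd a k.succ) := fun x k => by simp [f]
  have hker : LinearMap.ker (flatMap e A s l) ⊓ LinearMap.ker (frameMap a e) =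
      LinearMap.ker f := by
    ext x
    have hfr : frameMap a e x = 0 ↔ ∀ k : Fin e, x (Fin.natAdd a k.succ) = 0 := by
      rw [funext_iff]; rfl
    rw [Submodule.mem_inf, LinearMap.mem_ker, LinearMap.mem_ker, LinearMap.mem_ker, hfr,
      funext_iff, funext_iff (f := f x), Fin.forall_fin_succ, Fin.forall_fin_succ]
    simp only [hf0, hfs, flatMap_zero, flatMap_succ, Pi.zero_apply]
    constructor
    · rintro ⟨⟨h1, -⟩, h2⟩
      rw [Fin.sum_univ_succ] at h1
      simp only [h2, mul_zero, Finset.sum_const_zero, add_zero, Fin.val_zero, pow_zero,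
        one_mul] at h1
      exact ⟨h1, h2⟩
    · rintro ⟨h1, h2⟩
      refine ⟨⟨?_, fun j => by simp [h2]⟩, h2⟩
      rw [Fin.sum_univ_succ]
      simp only [h2, mul_zero, Finset.sum_const_zero, add_zero, Fin.val_zero, pow_zero, one_mul]
      exact h1
  have hsurj : Function.Surjective f := by
    intro y
    refine ⟨Fin.append 0 y, ?_⟩
    funext k
    refine Fin.cases ?_ (fun k => ?_) k
    · rw [hf0]; simp
    · rw [hfs]; simp
  rw [hker]
  have := finrank_ker_of_surjective f hsurj
  omega

end FlatIncidence

end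

noncomputable section

open MvPolynomial

namespace FlatIncidence

/-! ### The configuration of points and flats -/

/-- The `j`-th slope of the `i`-th flat: the residue of `x ^ (j+1)` modulo `p`, where
`x = i / (p * X)`. -/
def slopeNat (p X i j : ℕ) : ℕ := (i / (p * X)) ^ (j + 1) % p

/-- The `i`-th flat. -/
def confFlat (a r g p X G i : ℕ) : AffineSubspace ℝ (Fin (a + (r + g + 1)) → ℝ) :=
  flatOf (r + g) (fun j : Fin a => (slopeNat p X i j : ℝ)) ((i % (p * X) : ℕ) : ℝ) (i : ℝ)
    fun j : Fin g => ((j * G + i / G ^ (j : ℕ) % G : ℕ) : ℝ)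

/-- The point with coordinates `(z, w, 0, …, 0)`. -/
def confPoint {a X M : ℕ} (e : ℕ) (x : (Fin a → Fin X) × Fin M) : Fin (a + (e + 1)) → ℝ :=
  framePoint e (fun j => ((x.1 j : ℕ) : ℝ)) ((x.2 : ℕ) : ℝ)

open Classical in
/-- The point set. -/
def confPoints (a e p X : ℕ) : Finset (Fin (a + (e + 1)) → ℝ) :=
  (Finset.univ : Finset ((Fin a → Fin X) × Fin ((a + 1) * (p * X)))).image (confPoint e)

open Classical in
/-- The set of flats. -/
def confFlats (a r g p X G : ℕ) : Finset (AffineSubspace ℝ (Fin (a + (r + g + 1)) → ℝ)) :=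
  (Finset.univ : Finset (Fin (p * (p * X)))).image fun i : Fin (p * (p * X)) => confFlat a r g p X G i

theorem confPoint_injective {a X M e : ℕ} :
    Function.Injective (confPoint e : (Fin a → Fin X) × Fin M → _) := by
  rintro ⟨z, w⟩ ⟨z', w'⟩ h
  refine Prod.ext (funext fun j => Fin.ext ?_) (Fin.ext ?_)
  · have := congrFun h (Fin.castAdd (e + 1) j)
    simpa [confPoint, framePoint_castAdd] using this
  · have := congrFun h (Fin.natAdd a 0)
    simpa [confPoint, framePoint_natAdd_zero] using this

theorem card_confPoints (a e p X : ℕ) :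
    (confPoints a e p X).card = X ^ a * ((a + 1) * (p * X)) := by
  rw [confPoints, Finset.card_image_of_injective _ confPoint_injective]
  simp

theorem confPoint_mem_confFlat {a r g p X G M i : ℕ} (x : (Fin a → Fin X) × Fin M) :
    confPoint (r + g) x ∈ confFlat a r g p X G i ↔
      (x.2 : ℕ) = ∑ j : Fin a, slopeNat p X i j * x.1 j + i % (p * X) := by
  rw [confPoint, confFlat, framePoint_mem_flatOf]
  norm_cast

theorem eq_of_div_eq_of_mod_eq {M i i' : ℕ} (h1 : i / M = i' / M) (h2 : i % M = i' % M) :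
    i = i' := by
  rw [← Nat.div_add_mod i M, ← Nat.div_add_mod i' M, h1, h2]

theorem div_lt_of_fin {p X : ℕ} (i : Fin (p * (p * X))) : (i : ℕ) / (p * X) < p :=
  Nat.div_lt_of_lt_mul (by rw [mul_comm (p * X)]; exact i.2)

/-- Inside the frame, z = 0 reveals b and the first unit vector reveals the first slope, which is i
/ (pX) itself because that is below p. -/
theorem confFlat_injective {a r g p X G : ℕ} (ha : 0 < a) :
    Function.Injective fun i : Fin (p * (p * X)) => confFlat a r g p X G i := by
  intro i i' h
  have hz : ∀ (z : Fin a → ℝ) (w : ℝ),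
      w = ∑ j : Fin a, (slopeNat p X i j : ℝ) * z j + ((i % (p * X) : ℕ) : ℝ) →
      w = ∑ j : Fin a, (slopeNat p X i' j : ℝ) * z j + ((i' % (p * X) : ℕ) : ℝ) := by
    intro z w hw
    have h1 : framePoint (r + g) z w ∈ confFlat a r g p X G i :=
      (framePoint_mem_flatOf _ _ _ _ _ _).2 hw
    have h' : confFlat a r g p X G i = confFlat a r g p X G i' := h
    rw [h'] at h1
    exact (framePoint_mem_flatOf _ _ _ _ _ _).1 h1
  have hb := hz 0 _ rfl
  simp only [Pi.zero_apply, mul_zero, Finset.sum_const_zero, zero_add] at hb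
  have hA := hz (Pi.single ⟨0, ha⟩ 1) _ rfl
  simp only [Pi.single_apply, mul_ite, mul_one, mul_zero, Finset.sum_ite_eq', Finset.mem_univ,
    if_true, hb, add_left_inj] at hA
  have hA' : slopeNat p X i 0 = slopeNat p X i' 0 := by exact_mod_cast hA
  simp only [slopeNat, zero_add, pow_one, Nat.mod_eq_of_lt (div_lt_of_fin i),
    Nat.mod_eq_of_lt (div_lt_of_fin i')] at hA'
  exact Fin.ext (eq_of_div_eq_of_mod_eq hA' (by exact_mod_cast hb))

theorem card_confFlats {a r g p X G : ℕ} (ha : 0 < a) :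
    (confFlats a r g p X G).card = p * (p * X) := by
  classical
  rw [confFlats, Finset.card_image_of_injective _ (confFlat_injective ha)]
  simp

theorem fiber_labels_injective {g G i : ℕ} (hG : 0 < G) :
    Function.Injective fun j : Fin g => ((j * G + i / G ^ (j : ℕ) % G : ℕ) : ℝ) := by
  intro j j' h
  have h1 : (j : ℕ) * G + i / G ^ (j : ℕ) % G = j' * G + i / G ^ (j' : ℕ) % G :=
    Nat.cast_injective (R := ℝ) h
  have h2 := congrArg (· / G) h1
  have hx := Nat.mod_lt (i / G ^ (j : ℕ)) hG
  have hx' := Nat.mod_lt (i / G ^ (j' : ℕ)) hG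
  exact Fin.ext (by
    simpa [Nat.add_div_of_dvd_right, Nat.mul_div_cancel _ hG, Nat.div_eq_of_lt hx,
      Nat.div_eq_of_lt hx'] using h2)

theorem incidences_conf_ge {a r g p X G : ℕ} (ha : 0 < a) (hp : 0 < p) :
    p * (p * X) * X ^ a ≤ incidences (confPoints a (r + g) p X) (confFlats a r g p X G) := by
  classical
  have hwlt : ∀ (i : Fin (p * (p * X))) (z : Fin a → Fin X),
      ∑ j : Fin a, slopeNat p X i j * z j + i % (p * X) < (a + 1) * (p * X) := by
    intro i z
    have hpX : 0 < p * X := Nat.pos_of_mul_pos_left (i.pos)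
    have h1 : ∑ j : Fin a, slopeNat p X i j * (z j : ℕ) ≤ ∑ _j : Fin a, p * X :=
      Finset.sum_le_sum fun j _ => Nat.mul_le_mul (Nat.mod_lt _ hp).le (z j).2.le
    have h2 := Nat.mod_lt (i : ℕ) hpX
    simp only [Finset.sum_const, Finset.card_univ, Fintype.card_fin, smul_eq_mul] at h1
    have h3 : (a + 1) * (p * X) = a * (p * X) + p * X := by ring
    omega
  let f : Fin (p * (p * X)) × (Fin a → Fin X) →
      (Fin (a + (r + g + 1)) → ℝ) × AffineSubspace ℝ (Fin (a + (r + g + 1)) → ℝ) := fun y =>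
    (confPoint (r + g) (y.2, ⟨_, hwlt y.1 y.2⟩), confFlat a r g p X G y.1)
  have hf : Function.Injective f := by
    rintro ⟨i, z⟩ ⟨i', z'⟩ h
    have h1 := confFlat_injective ha (Prod.ext_iff.1 h).2
    have h2 := confPoint_injective (Prod.ext_iff.1 h).1
    exact Prod.ext h1 (Prod.ext_iff.1 h2).1
  have hfin : {e : (Fin (a + (r + g + 1)) → ℝ) × AffineSubspace ℝ (Fin (a + (r + g + 1)) → ℝ) |
      e.1 ∈ confPoints a (r + g) p X ∧ e.2 ∈ confFlats a r g p X G ∧ e.1 ∈ e.2}.Finite :=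
    ((confPoints a (r + g) p X) ×ˢ (confFlats a r g p X G)).finite_toSet.subset fun e he => by
      simpa using ⟨he.1, he.2.1⟩
  have hrange : Set.range f ⊆ {e | e.1 ∈ confPoints a (r + g) p X ∧
      e.2 ∈ confFlats a r g p X G ∧ e.1 ∈ e.2} := by
    rintro _ ⟨⟨i, z⟩, rfl⟩
    exact ⟨Finset.mem_image_of_mem _ (Finset.mem_univ _),
      Finset.mem_image_of_mem (fun i : Fin (p * (p * X)) => confFlat a r g p X G i)
        (Finset.mem_univ i), (confPoint_mem_confFlat _).2 rfl⟩
  have := Set.ncard_le_ncard hrange hfin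
  rw [← Set.image_univ, Set.ncard_image_of_injective _ hf, Set.ncard_univ, Nat.card_prod] at this
  simpa [incidences] using this

/-- Subtracting the incidence equations of two points eliminates b and, modulo p, leaves a
polynomial equation of degree at most a for x = i / (pX). It is nontrivial: X ≤ p keeps distinct
z-coordinates distinct modulo p, and equal z on a common flat would force equal w. Through a given
point x determines b, so at most a flats remain. -/
theorem noBiclique_conf {a r g p X G : ℕ} [Fact p.Prime] (hX : X ≤ p) :
    NoBiclique 2 (a + 1) (confPoints a (r + g) p X) (confFlats a r g p X G) := by
  classical
  intro S hS B hB hScard hBcard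
  by_contra hcon
  push Not at hcon
  obtain ⟨x, y, hxy, rfl⟩ := Finset.card_eq_two.1 hScard
  obtain ⟨u, -, rfl⟩ := Finset.mem_image.1 (hS (Finset.mem_insert_self x {y}))
  obtain ⟨u', -, rfl⟩ := Finset.mem_image.1
    (hS (Finset.mem_insert_of_mem (Finset.mem_singleton_self _)))
  let I : Finset (Fin (p * (p * X))) := Finset.univ.filter fun i => confFlat a r g p X G i ∈ B
  have hI : a + 1 ≤ I.card := by
    rw [← hBcard]
    have : B ⊆ I.image fun i : Fin (p * (p * X)) => confFlat a r g p X G i := by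
      intro v hv
      obtain ⟨i, -, rfl⟩ := Finset.mem_image.1 (hB hv)
      exact Finset.mem_image_of_mem (fun i : Fin (p * (p * X)) => confFlat a r g p X G i)
        (Finset.mem_filter.2 ⟨Finset.mem_univ i, hv⟩)
    exact (Finset.card_le_card this).trans Finset.card_image_le
  have h1 : ∀ i ∈ I, (u.2 : ℕ) = ∑ j : Fin a, slopeNat p X i j * u.1 j + i % (p * X) := fun i hi =>
    (confPoint_mem_confFlat u).1 (hcon _ (by simp) _ (Finset.mem_filter.1 hi).2)
  have h2 : ∀ i ∈ I, (u'.2 : ℕ) = ∑ j : Fin a, slopeNat p X i j * u'.1 j + i % (p * X) := fun i hi =>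
    (confPoint_mem_confFlat u').1 (hcon _ (by simp) _ (Finset.mem_filter.1 hi).2)
  have hne : ∃ j, u.1 j ≠ u'.1 j := by
    by_contra hall
    push Not at hall
    obtain ⟨i, hi⟩ : I.Nonempty := Finset.card_pos.1 (by omega)
    have e1 := h1 i hi
    have e2 := h2 i hi
    simp only [hall] at e1
    exact hxy (congrArg (confPoint (r + g)) (Prod.ext (funext hall) (Fin.ext (e1.trans e2.symm))))
  let Q : Polynomial (ZMod p) := ∑ j : Fin a,
    Polynomial.C (((u.1 j : ℕ) : ZMod p) - ((u'.1 j : ℕ) : ZMod p)) * Polynomial.X ^ ((j : ℕ) + 1) -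
      Polynomial.C (((u.2 : ℕ) : ZMod p) - ((u'.2 : ℕ) : ZMod p))
  have hQ0 : Q ≠ 0 := by
    obtain ⟨j, hj⟩ := hne
    intro h0
    have hc := congrArg (fun q => q.coeff ((j : ℕ) + 1)) h0
    simp only [Q, Polynomial.coeff_sub, Polynomial.finsetSum_coeff, Polynomial.coeff_C_mul_X_pow,
      Polynomial.coeff_C_succ, sub_zero, Polynomial.coeff_zero, add_left_inj, Fin.val_inj,
      Finset.sum_ite_eq, Finset.mem_univ, if_true] at hc
    rw [sub_eq_zero, ZMod.natCast_eq_natCast_iff', Nat.mod_eq_of_lt ((u.1 j).2.trans_le hX),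
      Nat.mod_eq_of_lt ((u'.1 j).2.trans_le hX)] at hc
    exact hj (Fin.ext hc)
  have hQd : Q.natDegree ≤ a := by
    refine (Polynomial.natDegree_sub_le_of_le ?_ (Polynomial.natDegree_C _).le).trans
      (max_le le_rfl (Nat.zero_le a))
    refine Polynomial.natDegree_sum_le_of_forall_le _ _ fun j _ => ?_
    exact (Polynomial.natDegree_C_mul_X_pow_le _ _).trans j.2
  let ρ : Fin (p * (p * X)) → ZMod p := fun i => ((i / (p * X) : ℕ) : ZMod p)
  have hroot : I.image ρ ⊆ Q.roots.toFinset := by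
    intro y hy
    obtain ⟨i, hi, rfl⟩ := Finset.mem_image.1 hy
    rw [Multiset.mem_toFinset, Polynomial.mem_roots hQ0, Polynomial.IsRoot.def]
    have e1 := congrArg (Nat.cast : ℕ → ZMod p) (h1 i hi)
    have e2 := congrArg (Nat.cast : ℕ → ZMod p) (h2 i hi)
    simp only [slopeNat, Nat.cast_add, Nat.cast_sum, Nat.cast_mul, ZMod.natCast_mod,
      Nat.cast_pow] at e1 e2
    simp only [Q, ρ, Polynomial.eval_sub, Polynomial.eval_finsetSum, Polynomial.eval_mul,
      Polynomial.eval_C, Polynomial.eval_pow, Polynomial.eval_X]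
    rw [e1, e2]
    simp only [sub_mul, Finset.sum_sub_distrib]
    simp only [mul_comm]
    ring
  have hρ : Set.InjOn ρ I := by
    intro i hi i' hi' h
    simp only [ρ] at h
    rw [ZMod.natCast_eq_natCast_iff', Nat.mod_eq_of_lt (div_lt_of_fin i),
      Nat.mod_eq_of_lt (div_lt_of_fin i')] at h
    have e1 := h1 i hi
    have e2 := h1 i' hi'
    have hsl : ∀ j : ℕ, slopeNat p X i j = slopeNat p X i' j := fun j : ℕ => by simp [slopeNat, h]
    simp only [hsl] at e1
    exact Fin.ext (eq_of_div_eq_of_mod_eq h (by omega))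
  have h3 := (Finset.card_le_card hroot).trans
    ((Multiset.toFinset_card_le _).trans ((Polynomial.card_roots' Q).trans hQd))
  rw [Finset.card_image_of_injOn hρ] at h3
  omega

/-- In every pair `(k', d'')` of `R_{k,d}` with `k' > a`, few flats of the configuration have
`k'`-dimensional intersection with a `d''`-dimensional variety. -/
theorem intersectionCondition_conf {a r g p X G c : ℕ} (ha : 0 < a)
    (hn : p * (p * X) ≤ G ^ (g + 1)) (q : ℕ × ℕ → ℕ)
    (hq : ∀ x, x.1 ≤ a → p * (p * X) ≤ q x)
    (hq' : ∀ x, a < x.1 → 4 ^ (a + (r + g + 1)) *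
      ((g + 1) * branching (a + (r + g + 1)) c * G ^ g) ≤ q x) :
    IntersectionCondition (a + r) c q (confFlats a r g p X G) := by
  classical
  rintro ⟨k', d''⟩ hx U hU hdim
  obtain ⟨hk1, hk, hd2, hd, hlt, hlt1⟩ := hx
  simp only at hk1 hk hd2 hd hlt hlt1 hdim ⊢
  have hset : {v | v ∈ confFlats a r g p X G ∧
      algDim ((v : Set (Fin (a + (r + g + 1)) → ℝ)) ∩ U) = (k' : WithBot ℕ∞)} =
      (fun i : Fin (p * (p * X)) => confFlat a r g p X G i) '' {i : Fin (p * (p * X)) |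
        algDim ((confFlat a r g p X G i : Set (Fin (a + (r + g + 1)) → ℝ)) ∩ U) =
          (k' : WithBot ℕ∞)} := by
    ext v
    simp only [confFlats, Set.mem_ofPred_eq, Finset.mem_image, Finset.mem_univ, true_and,
      Set.mem_image]
    constructor
    · rintro ⟨⟨i, rfl⟩, h⟩; exact ⟨i, h, rfl⟩
    · rintro ⟨i, h, rfl⟩; exact ⟨⟨i, rfl⟩, h⟩
  rw [hset, Set.ncard_image_of_injective _ (confFlat_injective ha)]
  by_cases hka : k' ≤ a
  · refine le_trans ?_ (hq (k', d'') hka)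
    refine (Set.ncard_le_ncard (Set.subset_univ _)).trans ?_
    rw [Set.ncard_univ, Nat.card_fin]
  -- The codimension inside the variety drops: d''(1 - k'/d'') < d(1 - k/d) = g + 1.
  · have hgap : d'' < g + 1 + k' := by
      have hd0 : (0 : ℚ) < ((a + (r + g + 1) : ℕ) : ℚ) := by positivity
      have hd''0 : (0 : ℚ) < (d'' : ℚ) := by exact_mod_cast (by omega : 0 < d'')
      rw [div_lt_div_iff₀ hd0 hd''0] at hlt
      have h1 : (a + r) * d'' < k' * (a + (r + g + 1)) := by exact_mod_cast hlt
      by_contra hge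
      have h2 : k' ≤ d'' - (g + 1) := by omega
      obtain ⟨s, hs⟩ : ∃ s, d'' = s + (g + 1) := ⟨d'' - (g + 1), by omega⟩
      have h3 : k' ≤ s := by omega
      have h4 : s ≤ a + r := by omega
      subst hs
      nlinarith
    refine le_trans ?_ (hq' (k', d'') (by simpa using hka))
    refine card_large_intersection_le (Nat.le_add_left g r) hn
      (fun i j => (slopeNat p X i j : ℝ)) (fun i => ((i % (p * X) : ℕ) : ℝ)) _ ?_ ?_ hU
      (δ := d'') (le_of_eq hdim) hd (by omega) (by omega) hgap
    · intro i x hx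
      exact ((mem_flatOf _ _ _ _ _).1 hx).1
    · intro i x hx j hj
      exact ((mem_flatOf _ _ _ _ _).1 hx).2 ⟨j, hj⟩

end FlatIncidence

end

noncomputable section


namespace FlatIncidence

/-! ### The exponents of the terms of the incidence bound -/

theorem IsSignificant.tail {h : ℕ × ℕ} {τ : List (ℕ × ℕ)} (hs : IsSignificant (h :: τ)) :
    IsSignificant τ :=
  ⟨fun p hp => hs.1 p (List.mem_cons_of_mem _ hp), (List.pairwise_cons.1 hs.2).2⟩

/-- The difference is a fraction with a positive integer numerator and a denominator of at most d².
-/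
theorem codimWeight_gap {h x : ℕ × ℕ} {τ : List (ℕ × ℕ)} (hs : IsSignificant (h :: x :: τ)) {d : ℕ}
    (hd : h.2 ≤ d) : 1 / (d : ℝ) ^ 2 ≤ codimWeight x - codimWeight h := by
  obtain ⟨hk1, hd1, hlt1⟩ := hs.1 h (by simp)
  obtain ⟨hk2, hd2, hlt2⟩ := hs.1 x (by simp)
  obtain ⟨hk, hdd, hr⟩ := (List.pairwise_cons.1 hs.2).1 x (by simp)
  have e1 : (0 : ℚ) < (h.2 : ℚ) := by exact_mod_cast (by omega : 0 < h.2)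
  have e2 : (0 : ℚ) < (x.2 : ℚ) := by exact_mod_cast (by omega : 0 < x.2)
  rw [div_lt_div_iff₀ e1 e2] at hr
  have hr' : h.1 * x.2 + 1 ≤ x.1 * h.2 := by exact_mod_cast hr
  have hr'' : (h.1 : ℝ) * x.2 + 1 ≤ x.1 * h.2 := by exact_mod_cast hr'
  have f1 : (1 : ℝ) ≤ (h.2 : ℝ) - h.1 := by
    have : (h.1 : ℝ) + 1 ≤ h.2 := by exact_mod_cast hlt1
    linarith
  have f2 : (1 : ℝ) ≤ (x.2 : ℝ) - x.1 := by
    have : (x.1 : ℝ) + 1 ≤ x.2 := by exact_mod_cast hlt2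
    linarith
  have g1 : (h.2 : ℝ) - h.1 ≤ d := by
    have : (h.2 : ℝ) ≤ d := by exact_mod_cast hd
    have : (0 : ℝ) ≤ h.1 := by positivity
    linarith
  have g2 : (x.2 : ℝ) - x.1 ≤ d := by
    have : (x.2 : ℝ) ≤ d := by exact_mod_cast (by omega : x.2 ≤ d)
    have : (0 : ℝ) ≤ x.1 := by positivity
    linarith
  have hprod : ((h.2 : ℝ) - h.1) * ((x.2 : ℝ) - x.1) ≤ (d : ℝ) ^ 2 := by
    rw [sq]; exact mul_le_mul g1 g2 (by linarith) (by linarith)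
  have hpos : 0 < ((h.2 : ℝ) - h.1) * ((x.2 : ℝ) - x.1) := by positivity
  have heq : codimWeight x - codimWeight h =
      ((x.1 : ℝ) * h.2 - h.1 * x.2) / (((h.2 : ℝ) - h.1) * ((x.2 : ℝ) - x.1)) := by
    have n1 : (h.2 : ℝ) - h.1 ≠ 0 := by linarith
    have n2 : (x.2 : ℝ) - x.1 ≠ 0 := by linarith
    rw [codimWeight, codimWeight, div_sub_div _ _ n2 n1]
    congr 1 <;> ring
  rw [heq]
  calc 1 / (d : ℝ) ^ 2 ≤ 1 / (((h.2 : ℝ) - h.1) * ((x.2 : ℝ) - x.1)) :=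
        one_div_le_one_div_of_le hpos hprod
    _ ≤ _ := by gcongr; linarith

/-- The exponent that the factors `q_{k_j,d_j}` contribute when `q_x` has exponent `θ x`. -/
def weightSum (θ : ℕ × ℕ → ℝ) (h : ℕ × ℕ) (τ : List (ℕ × ℕ)) : ℝ :=
  (((h :: τ).zip τ).map fun e => (codimWeight e.2 - codimWeight e.1) * θ e.2).sum

theorem weightSum_cons (θ : ℕ × ℕ → ℝ) (h x : ℕ × ℕ) (τ : List (ℕ × ℕ)) :
    weightSum θ h (x :: τ) = (codimWeight x - codimWeight h) * θ x + weightSum θ x τ := by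
  simp [weightSum]

theorem weightSum_le {d : ℕ} {θ : ℕ × ℕ → ℝ} {ν : ℝ} (hθ : ∀ x, θ x ≤ ν) :
    ∀ (τ : List (ℕ × ℕ)) (h : ℕ × ℕ), IsSignificant (h :: τ) → h.2 ≤ d →
      weightSum θ h τ ≤ ν * (codimWeight (τ.getLastD h) - codimWeight h) := by
  intro τ
  induction τ with
  | nil => intro h _ _; simp [weightSum]
  | cons x τ ih =>
    intro h hs hd
    have h1 := codimWeight_gap hs hd
    have hx := ((List.pairwise_cons.1 hs.2).1 x (by simp)).2.1
    have h2 := ih x hs.tail (by omega)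
    have h3 : 0 ≤ 1 / (d : ℝ) ^ 2 := by positivity
    have h4 := mul_le_mul_of_nonneg_left (hθ x) (h3.trans h1)
    rw [List.getLastD_cons, weightSum_cons]
    linarith

/-- The weights telescope as in `weightSum_le`; a single deficient parameter costs η times its
weight gap. -/
theorem weightSum_le_of_mem {d : ℕ} {θ : ℕ × ℕ → ℝ} {ν η : ℝ} (hη : 0 ≤ η) (hθ : ∀ x, θ x ≤ ν) :
    ∀ (τ : List (ℕ × ℕ)) (h : ℕ × ℕ), IsSignificant (h :: τ) → h.2 ≤ d →
      (∃ x ∈ τ, θ x ≤ ν - η) →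
      weightSum θ h τ ≤ ν * (codimWeight (τ.getLastD h) - codimWeight h) - η / (d : ℝ) ^ 2 := by
  intro τ
  induction τ with
  | nil => intro h _ _ hex; simp at hex
  | cons x τ ih =>
    intro h hs hd hex
    have h1 := codimWeight_gap hs hd
    have hx := ((List.pairwise_cons.1 hs.2).1 x (by simp)).2.1
    have h3 : 0 ≤ 1 / (d : ℝ) ^ 2 := by positivity
    rw [List.getLastD_cons, weightSum_cons]
    by_cases hxx : θ x ≤ ν - η
    · have h2 := weightSum_le hθ τ x hs.tail (d := d) (by omega)
      have h4 := mul_le_mul_of_nonneg_left hxx (h3.trans h1)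
      have h5 := mul_le_mul_of_nonneg_right h1 hη
      have h6 : 1 / (d : ℝ) ^ 2 * η = η / (d : ℝ) ^ 2 := by ring
      linarith
    · have hex' : ∃ y ∈ τ, θ y ≤ ν - η := by
        obtain ⟨y, hy, hyθ⟩ := hex
        rcases List.mem_cons.1 hy with rfl | hy
        · exact absurd hyθ hxx
        · exact ⟨y, hy, hyθ⟩
      have h2 := ih x hs.tail (by omega) hex'
      have h4 := mul_le_mul_of_nonneg_left (hθ x) (h3.trans h1)
      linarith

theorem prod_zip_le {d : ℕ} {q : ℕ × ℕ → ℕ} {θ : ℕ × ℕ → ℝ} {c X : ℝ} (hc : 0 < c) (hX : 0 < X)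
    (hq : ∀ x, (q x : ℝ) ≤ c * X ^ θ x) :
    ∀ (τ : List (ℕ × ℕ)) (h : ℕ × ℕ), IsSignificant (h :: τ) → h.2 ≤ d →
      (((h :: τ).zip τ).map fun e => (q e.2 : ℝ) ^ (codimWeight e.2 - codimWeight e.1)).prod ≤
        c ^ (codimWeight (τ.getLastD h) - codimWeight h) * X ^ weightSum θ h τ := by
  intro τ
  induction τ with
  | nil => intro h _ _; simp [weightSum]
  | cons x τ ih =>
    intro h hs hd
    have h1 := codimWeight_gap hs hd
    have hx := ((List.pairwise_cons.1 hs.2).1 x (by simp)).2.1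
    have h3 : 0 ≤ 1 / (d : ℝ) ^ 2 := by positivity
    have h2 := ih x hs.tail (by omega)
    rw [List.getLastD_cons, weightSum_cons, List.zip_cons_cons, List.map_cons, List.prod_cons]
    have h4 : (q x : ℝ) ^ (codimWeight x - codimWeight h) ≤
        c ^ (codimWeight x - codimWeight h) * X ^ ((codimWeight x - codimWeight h) * θ x) := by
      refine (Real.rpow_le_rpow (by positivity) (hq x) (h3.trans h1)).trans ?_
      rw [Real.mul_rpow hc.le (by positivity), ← Real.rpow_mul hX.le, mul_comm (θ x)]
    have h5 : 0 ≤ (((x :: τ).zip τ).map fun e =>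
        (q e.2 : ℝ) ^ (codimWeight e.2 - codimWeight e.1)).prod := by
      refine List.prod_nonneg fun y hy => ?_
      obtain ⟨e, -, rfl⟩ := List.mem_map.1 hy
      positivity
    refine (mul_le_mul h4 h2 h5 (by positivity)).trans (le_of_eq ?_)
    rw [Real.rpow_add hX, mul_mul_mul_comm, ← Real.rpow_add hc]
    congr 2
    ring

/-- The exponent of the term of `τ`, when `m`, `n`, `q_x` have exponents `μ`, `ν`, `θ x`. -/
def termExponent (k d : ℕ) (ε μ ν : ℝ) (θ : ℕ × ℕ → ℝ) (τ : List (ℕ × ℕ)) : ℝ :=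
  let l : ℕ × ℕ := τ.getLastD (k, d)
  (2 * l.1 / (l.2 + l.1) + ε) * μ +
    (ν * codimWeight (k, d) + weightSum θ (k, d) τ) * ((l.2 - l.1) / (l.2 + l.1))

theorem last_mem_or_eq {h : ℕ × ℕ} (τ : List (ℕ × ℕ)) : τ.getLastD h = h ∨ τ.getLastD h ∈ τ := by
  rcases List.eq_nil_or_concat τ with rfl | ⟨l, x, rfl⟩
  · simp
  · right; simp

theorem last_spec {k d : ℕ} {τ : List (ℕ × ℕ)} (hs : IsSignificant ((k, d) :: τ)) :
    1 ≤ (τ.getLastD (k, d)).1 ∧ (τ.getLastD (k, d)).1 < (τ.getLastD (k, d)).2 ∧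
      (τ.getLastD (k, d)).2 ≤ d := by
  have hmem : τ.getLastD (k, d) ∈ (k, d) :: τ := by
    rcases last_mem_or_eq (h := (k, d)) τ with h | h
    · rw [h]; exact List.mem_cons_self
    · exact List.mem_cons_of_mem _ h
  obtain ⟨h1, -, h2⟩ := hs.1 _ hmem
  refine ⟨h1, h2, ?_⟩
  rcases last_mem_or_eq (h := (k, d)) τ with h | h
  · rw [h]
  · exact ((List.pairwise_cons.1 hs.2).1 _ h).2.1.le

theorem exists_boundTerm_le {k d : ℕ} {ε μ ν c : ℝ} (hε : 0 ≤ ε) {θ : ℕ × ℕ → ℝ}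
    (hc : 0 < c) {τ : List (ℕ × ℕ)} (hs : IsSignificant ((k, d) :: τ)) :
    ∃ c' : ℝ, 0 ≤ c' ∧ ∀ (X : ℝ) (m n : ℕ) (q : ℕ × ℕ → ℕ), 0 < X → (m : ℝ) ≤ c * X ^ μ →
      (n : ℝ) ≤ c * X ^ ν → (∀ x, (q x : ℝ) ≤ c * X ^ θ x) →
      boundTerm 2 k d ε m n q τ ≤ c' * X ^ termExponent k d ε μ ν θ τ := by
  obtain ⟨h1, h2, h3⟩ := last_spec hs
  set l := τ.getLastD (k, d) with hl
  have hlr : (l.1 : ℝ) < l.2 := by exact_mod_cast h2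
  have hl0 : (0 : ℝ) < l.1 := by exact_mod_cast h1
  set y : ℝ := ((l.2 : ℝ) - l.1) / (l.2 + l.1) with hy
  have hy0 : 0 ≤ y := div_nonneg (by linarith) (by linarith)
  set x : ℝ := 2 * l.1 / (l.2 + l.1) + ε with hx
  have hx0 : 0 ≤ x := by positivity
  have hw0 : 0 ≤ codimWeight (k, d) := by
    have := (hs.1 (k, d) (by simp)).2.2
    have h' : (k : ℝ) < d := by exact_mod_cast this
    exact div_nonneg (by positivity) (by simp only; linarith)
  refine ⟨c ^ x * (c ^ codimWeight (k, d) *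
    c ^ (codimWeight l - codimWeight (k, d))) ^ y, by positivity, ?_⟩
  intro X m n q hX hm hn hq
  have hprod := prod_zip_le (d := d) hc hX hq τ (k, d) hs le_rfl
  rw [← hl] at hprod
  have hprod0 : 0 ≤ ((((k, d) :: τ).zip τ).map fun e =>
      (q e.2 : ℝ) ^ (codimWeight e.2 - codimWeight e.1)).prod := by
    refine List.prod_nonneg fun y hy => ?_
    obtain ⟨e, -, rfl⟩ := List.mem_map.1 hy
    positivity
  have hterm : boundTerm 2 k d ε m n q τ = (m : ℝ) ^ x * ((n : ℝ) ^ codimWeight (k, d) *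
      ((((k, d) :: τ).zip τ).map fun e =>
        (q e.2 : ℝ) ^ (codimWeight e.2 - codimWeight e.1)).prod) ^ y := by
    simp only [boundTerm, ← hl, hx, hy]
    have e1 : ((2 : ℕ) : ℝ) * l.2 - l.2 + l.1 = l.2 + l.1 := by push_cast; ring
    rw [e1]
    congr 2
    push_cast
    ring
  have hM : (m : ℝ) ^ x ≤ c ^ x * X ^ (x * μ) := by
    refine (Real.rpow_le_rpow (by positivity) hm hx0).trans ?_
    rw [Real.mul_rpow hc.le (by positivity), ← Real.rpow_mul hX.le, mul_comm μ]
  have hN : (n : ℝ) ^ codimWeight (k, d) ≤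
      c ^ codimWeight (k, d) * X ^ (ν * codimWeight (k, d)) := by
    refine (Real.rpow_le_rpow (by positivity) hn hw0).trans ?_
    rw [Real.mul_rpow hc.le (by positivity), ← Real.rpow_mul hX.le]
  rw [hterm]
  have hin := mul_le_mul hN hprod hprod0 (by positivity)
  rw [mul_mul_mul_comm, ← Real.rpow_add hX] at hin
  have hin' := Real.rpow_le_rpow (by positivity) hin hy0
  rw [Real.mul_rpow (x := c ^ codimWeight (k, d) * c ^ (codimWeight l - codimWeight (k, d)))
    (by positivity) (by positivity), ← Real.rpow_mul hX.le] at hin'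
  refine (mul_le_mul hM hin' (by positivity) (by positivity)).trans (le_of_eq ?_)
  rw [mul_mul_mul_comm, ← Real.rpow_add hX]
  rfl

/-- The exponents of the parameters `q_x` in the configuration, where `q_{a,a+1}` is removed. -/
def confExponent (a g : ℕ) (ν : ℝ) (x : ℕ × ℕ) : ℝ :=
  if x.1 ≤ a ∧ x ≠ (a, a + 1) then ν else ν - ν / (g + 1)

/-- x₁/x₂ ≤ x₁/(x₁+1) ≤ a/(a+1), with equality throughout only at (a, a+1); over the integers the
strict inequality gains 1. -/
theorem ratio_gap_of_le {a : ℕ} (ha : 0 < a) (x : ℕ × ℕ) (hlt : x.1 < x.2) (hx : x.1 ≤ a)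
    (hne : x ≠ (a, a + 1)) : (a + 1) * x.1 + 1 ≤ a * x.2 := by
  obtain ⟨u, v⟩ := x
  simp only at hlt hx ⊢
  rcases Nat.lt_trichotomy v (a + 1) with h | h | h
  · obtain ⟨s, rfl⟩ : ∃ s, v = u + 1 + s := ⟨v - (u + 1), by omega⟩
    nlinarith
  · subst h
    have : u ≠ a := fun h => hne (by rw [h])
    have hu : u + 1 ≤ a := by omega
    nlinarith
  · nlinarith

/-- If no entry of τ is deficient, the exponent telescopes and k_u/d_u < a/(a+1) leaves a margin of
1/(2d), half of which absorbs ε; for empty τ this is r < a g. Otherwise a deficient entry loses at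
least ν / (2d³(g+1)), and K is so large that this exceeds a + 2, more than the rest can make up. -/
theorem termExponent_le {a r g : ℕ} (ha : 0 < a) (hr : r < a * g) {K : ℕ} {ε : ℝ}
    (hK : (a + (r + g + 1)) ^ 3 * (g + 1) * (a + 2) ≤ K)
    (hε : ε * ((K : ℝ) + a + 1) ≤ 1 / (4 * ((a + (r + g + 1) : ℕ) : ℝ))) {τ : List (ℕ × ℕ)}
    (hs : IsSignificant ((a + r, a + (r + g + 1)) :: τ)) :
    termExponent (a + r) (a + (r + g + 1)) ε ((K : ℝ) + a + 1) (2 * K + 1)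
        (confExponent a g (2 * K + 1)) τ ≤
      2 * K + a + 1 - 1 / (4 * ((a + (r + g + 1) : ℕ) : ℝ)) := by
  set d := a + (r + g + 1) with hd
  set k := a + r
  obtain ⟨h1, h2, h3⟩ := last_spec hs
  have hmem := last_mem_or_eq (h := (k, d)) τ
  rw [termExponent]
  set l := τ.getLastD (k, d) with hl
  set ν : ℝ := 2 * K + 1 with hν
  have hν0 : 0 ≤ ν := by positivity
  have hlr : (l.1 : ℝ) + 1 ≤ l.2 := by exact_mod_cast h2
  have hl0 : (1 : ℝ) ≤ l.1 := by exact_mod_cast h1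
  have hld : (l.2 : ℝ) ≤ d := by exact_mod_cast h3
  have hd0 : (0 : ℝ) < d := by linarith
  set den : ℝ := (l.2 : ℝ) + l.1 with hden
  have hden0 : 0 < den := by linarith
  have hden2 : den ≤ 2 * d := by linarith
  have hθ : ∀ x, confExponent a g ν x ≤ ν := fun x => by
    rw [confExponent]
    split_ifs
    · exact le_rfl
    · have : 0 ≤ ν / ((g : ℝ) + 1) := by positivity
      linarith
  have hwy : codimWeight l * (((l.2 : ℝ) - l.1) / den) = l.2 / den := by
    have : (l.2 : ℝ) - l.1 ≠ 0 := by linarith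
    rw [codimWeight]
    field_simp
  have hy : 1 / (2 * (d : ℝ)) ≤ ((l.2 : ℝ) - l.1) / den :=
    (one_div_le_one_div_of_le hden0 hden2).trans (by gcongr; linarith)
  have hy0 : 0 ≤ ((l.2 : ℝ) - l.1) / den := le_trans (by positivity) hy
  have hmain : 2 * (l.1 : ℝ) / den * ((K : ℝ) + a + 1) + ν * (l.2 / den) =
      2 * K + (2 * l.1 * (a + 1) + l.2) / den := by
    rw [hν]
    field_simp
    rw [hden]
    ring
  have hsmall : 1 / (4 * (d : ℝ)) + 1 / (4 * (d : ℝ)) = 1 / (2 * (d : ℝ)) := by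
    field_simp
    norm_num
  by_cases hgood : ∀ x ∈ τ, x.1 ≤ a ∧ x ≠ (a, a + 1)
  · have hw := weightSum_le hθ τ (k, d) hs (d := d) le_rfl
    rw [← hl] at hw
    have hgap : (a + 1) * l.1 + 1 ≤ a * l.2 := by
      rcases hmem with h | h
      · rw [h]
        simp only [hd, k]
        nlinarith
      · exact ratio_gap_of_le ha l h2 (hgood l h).1 (hgood l h).2
    have hgap' : ((a : ℝ) + 1) * l.1 + 1 ≤ a * l.2 := by exact_mod_cast hgap
    have hq : (2 * (l.1 : ℝ) * (a + 1) + l.2) / den ≤ a + 1 - 1 / (2 * d) := by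
      have e1 : (2 * (l.1 : ℝ) * (a + 1) + l.2) / den ≤ ((a + 1) * den - 1) / den := by
        gcongr
        rw [hden]
        linarith
      have e2 : ((a + 1) * den - 1) / den = (a + 1 : ℝ) - 1 / den := by field_simp
      have e3 := one_div_le_one_div_of_le hden0 hden2
      linarith
    have hw' : (ν * codimWeight (k, d) + weightSum (confExponent a g ν) (k, d) τ) *
        (((l.2 : ℝ) - l.1) / den) ≤ ν * (l.2 / den) := by
      rw [← hwy, ← mul_assoc]
      exact mul_le_mul_of_nonneg_right (by linarith) hy0
    have : (2 * (l.1 : ℝ) / den + ε) * ((K : ℝ) + a + 1) =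
      2 * (l.1 : ℝ) / den * ((K : ℝ) + a + 1) + ε * ((K : ℝ) + a + 1) := by ring
    linarith
  · push Not at hgood
    obtain ⟨x, hx, hxbad⟩ := hgood
    have hη0 : 0 ≤ ν / ((g : ℝ) + 1) := by positivity
    have hw := weightSum_le_of_mem hη0 hθ τ (k, d) hs (d := d) le_rfl ⟨x, hx, by
      rw [confExponent, if_neg fun h => h.2 (hxbad h.1)]⟩
    rw [← hl] at hw
    have hw' : (ν * codimWeight (k, d) + weightSum (confExponent a g ν) (k, d) τ) *
        (((l.2 : ℝ) - l.1) / den) ≤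
        ν * (l.2 / den) - ν / ((g : ℝ) + 1) / (d : ℝ) ^ 2 * (1 / (2 * d)) := by
      rw [← hwy]
      have e1 : (ν * codimWeight (k, d) + weightSum (confExponent a g ν) (k, d) τ) *
          (((l.2 : ℝ) - l.1) / den) ≤ (ν * codimWeight l - ν / ((g : ℝ) + 1) / (d : ℝ) ^ 2) *
          (((l.2 : ℝ) - l.1) / den) := mul_le_mul_of_nonneg_right (by linarith) hy0
      have e2 : ν / ((g : ℝ) + 1) / (d : ℝ) ^ 2 * (1 / (2 * d)) ≤
          ν / ((g : ℝ) + 1) / (d : ℝ) ^ 2 * (((l.2 : ℝ) - l.1) / den) :=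
        mul_le_mul_of_nonneg_left hy (by positivity)
      linarith
    have hq : (2 * (l.1 : ℝ) * (a + 1) + l.2) / den ≤ 2 * (a + 1) := by
      rw [div_le_iff₀ hden0, hden]
      have : (0 : ℝ) ≤ a := by positivity
      nlinarith
    have hloss : (a : ℝ) + 2 ≤ ν / ((g : ℝ) + 1) / (d : ℝ) ^ 2 * (1 / (2 * d)) := by
      have hK' : (d : ℝ) ^ 3 * (g + 1) * (a + 2) ≤ K := by exact_mod_cast hK
      have e1 : ν / ((g : ℝ) + 1) / (d : ℝ) ^ 2 * (1 / (2 * d)) =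
          ν / (2 * ((d : ℝ) ^ 3 * (g + 1))) := by field_simp
      rw [e1, le_div_iff₀ (by positivity), hν]
      nlinarith
    have hd1 : 1 / (2 * (d : ℝ)) ≤ 1 := by
      rw [div_le_one (by positivity)]
      linarith
    have : (2 * (l.1 : ℝ) / den + ε) * ((K : ℝ) + a + 1) =
      2 * (l.1 : ℝ) / den * ((K : ℝ) + a + 1) + ε * ((K : ℝ) + a + 1) := by ring
    linarith

end FlatIncidence

end

noncomputable section


namespace FlatIncidence

/-! ### The violation of the incidence bound -/

theorem exists_pow_ge_le_rpow {n : ℕ} (hn : 0 < n) (g : ℕ) :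
    ∃ G : ℕ, n ≤ G ^ (g + 1) ∧ ((G ^ g : ℕ) : ℝ) ≤ 2 ^ g * (n : ℝ) ^ ((g : ℝ) / (g + 1)) := by
  have hn1 : (1 : ℝ) ≤ n := by exact_mod_cast hn
  have hg : (0 : ℝ) < (g : ℝ) + 1 := by positivity
  set y : ℝ := (n : ℝ) ^ (1 / ((g : ℝ) + 1)) with hy
  have hy1 : 1 ≤ y := Real.one_le_rpow hn1 (by positivity)
  have hyG : y ≤ ⌈y⌉₊ := Nat.le_ceil y
  have hG : (⌈y⌉₊ : ℝ) ≤ 2 * y := by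
    have := Nat.ceil_lt_add_one (zero_le_one.trans hy1)
    linarith
  refine ⟨⌈y⌉₊, ?_, ?_⟩
  · have h1 : y ^ (g + 1) = n := by
      rw [hy, ← Real.rpow_natCast, ← Real.rpow_mul (by positivity)]
      push_cast
      rw [one_div_mul_cancel hg.ne', Real.rpow_one]
    have h2 : y ^ (g + 1) ≤ (⌈y⌉₊ : ℝ) ^ (g + 1) := by gcongr
    rw [h1] at h2
    exact_mod_cast h2
  · push_cast
    calc (⌈y⌉₊ : ℝ) ^ g ≤ (2 * y) ^ g := by gcongr
      _ = 2 ^ g * (n : ℝ) ^ ((g : ℝ) / (g + 1)) := by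
        rw [mul_pow, hy, ← Real.rpow_natCast, ← Real.rpow_natCast (_ ^ _), ← Real.rpow_mul
          (by positivity)]
        congr 2
        ring

theorem exists_incidenceBound_le {a r g : ℕ} (ha : 0 < a) (hr : r < a * g) {K : ℕ} {ε c : ℝ}
    (hK : (a + (r + g + 1)) ^ 3 * (g + 1) * (a + 2) ≤ K) (hε0 : 0 ≤ ε) (hc : 0 < c)
    (hε : ε * ((K : ℝ) + a + 1) ≤ 1 / (4 * ((a + (r + g + 1) : ℕ) : ℝ))) :
    ∃ c' : ℝ, 0 ≤ c' ∧ ∀ (X : ℝ) (m n : ℕ) (q : ℕ × ℕ → ℕ), 1 ≤ X →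
      (m : ℝ) ≤ c * X ^ ((K : ℝ) + a + 1) → (n : ℝ) ≤ c * X ^ (2 * (K : ℝ) + 1) →
      (∀ x, (q x : ℝ) ≤ c * X ^ confExponent a g (2 * K + 1) x) →
      incidenceBound 2 (a + r) (a + (r + g + 1)) ε m n q ≤
        c' * X ^ (2 * (K : ℝ) + a + 1 - 1 / (4 * ((a + (r + g + 1) : ℕ) : ℝ))) := by
  set d := a + (r + g + 1) with hd
  set S := (significantTails_finite (a + r) d).toFinset
  have hS : ∀ τ ∈ S, IsSignificant ((a + r, d) :: τ) := fun τ hτ =>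
    (significantTails_finite (a + r) d).mem_toFinset.1 hτ
  choose! c' hc' hle using fun (τ : List (ℕ × ℕ)) (hτ : τ ∈ S) =>
    exists_boundTerm_le (ε := ε) (μ := (K : ℝ) + a + 1) (ν := 2 * K + 1) (c := c) hε0
      (θ := confExponent a g (2 * K + 1)) hc (hS τ hτ)
  refine ⟨∑ τ ∈ S, c' τ + c + c, by
    have := Finset.sum_nonneg hc'
    positivity, ?_⟩
  intro X m n q hX hm hn hq
  have hX0 : 0 < X := by linarith
  have hd1 : (1 : ℝ) ≤ d := by exact_mod_cast (by omega : 1 ≤ d)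
  have hsmall : 1 / (4 * (d : ℝ)) ≤ 1 := by
    rw [div_le_one (by positivity)]
    linarith
  have ha1 : (1 : ℝ) ≤ a := by exact_mod_cast ha
  have hK1 : (1 : ℝ) ≤ K := by
    have : 1 ≤ K := le_trans (Nat.succ_le_of_lt (by positivity)) hK
    exact_mod_cast this
  have hm' : (m : ℝ) ≤ c * X ^ (2 * (K : ℝ) + a + 1 - 1 / (4 * (d : ℝ))) :=
    hm.trans (by gcongr ?_ * ?_; exact Real.rpow_le_rpow_of_exponent_le hX (by linarith))
  have hn' : (n : ℝ) ≤ c * X ^ (2 * (K : ℝ) + a + 1 - 1 / (4 * (d : ℝ))) :=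
    hn.trans (by gcongr ?_ * ?_; exact Real.rpow_le_rpow_of_exponent_le hX (by linarith))
  have hsum : ∑ τ ∈ S, boundTerm 2 (a + r) d ε m n q τ ≤
      (∑ τ ∈ S, c' τ) * X ^ (2 * (K : ℝ) + a + 1 - 1 / (4 * (d : ℝ))) := by
    rw [Finset.sum_mul]
    refine Finset.sum_le_sum fun τ hτ => (hle τ hτ X m n q hX0 hm hn hq).trans ?_
    have := hc' τ hτ
    gcongr ?_ * ?_
    exact Real.rpow_le_rpow_of_exponent_le hX (termExponent_le ha hr hK hε (hS τ hτ))
  rw [incidenceBound]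
  linarith

theorem incidenceBound_nonneg (s k d : ℕ) (ε : ℝ) (m n : ℕ) (q : ℕ × ℕ → ℕ) :
    0 ≤ incidenceBound s k d ε m n q := by
  have : ∀ τ, 0 ≤ boundTerm s k d ε m n q τ := fun τ => by
    have h : 0 ≤ ((((k, d) :: τ).zip τ).map fun e =>
        (q e.2 : ℝ) ^ (codimWeight e.2 - codimWeight e.1)).prod := by
      refine List.prod_nonneg fun y hy => ?_
      obtain ⟨e, -, rfl⟩ := List.mem_map.1 hy
      positivity
    simp only [boundTerm]
    positivity
  have := Finset.sum_nonneg fun τ (_ : τ ∈ (significantTails_finite k d).toFinset) => this τ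
  rw [incidenceBound]
  positivity

theorem exists_dims_of_ratio_lt {k d d' : ℕ} (hd : 0 < d) (hd' : 0 < d')
    (hratio : (k : ℝ) / d < ((d' : ℝ) - 1) / d') (hle : d' - 1 ≤ k) :
    ∃ a r g : ℕ, 0 < a ∧ r < a * g ∧ d' = a + 1 ∧ k = a + r ∧ d = a + (r + g + 1) := by
  obtain ⟨a, rfl⟩ : ∃ a, d' = a + 1 := ⟨d' - 1, by omega⟩
  obtain ⟨r, rfl⟩ : ∃ r, k = a + r := ⟨k - a, by omega⟩
  rw [div_lt_div_iff₀ (by exact_mod_cast hd) (by exact_mod_cast hd')] at hratio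
  push_cast at hratio
  have h : (a + r) * (a + 1) < a * d := by
    have : ((a : ℝ) + r) * (a + 1) < a * d := by linarith
    exact_mod_cast this
  have ha : 0 < a := by
    rcases Nat.eq_zero_or_pos a with rfl | h0
    · simp at h
    · exact h0
  have hlt : a + r < d := by
    by_contra hcon
    have : a * d ≤ a * (a + r) := Nat.mul_le_mul_left a (by omega)
    nlinarith
  obtain ⟨g, rfl⟩ : ∃ g, d = a + (r + g + 1) := ⟨d - a - r - 1, by omega⟩
  exact ⟨a, r, g, ha, by nlinarith, rfl, rfl, rfl⟩

theorem exists_configuration {a r g : ℕ} (ha : 0 < a) (hr : r < a * g) {K : ℕ} {ε : ℝ}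
    (hK : (a + (r + g + 1)) ^ 3 * (g + 1) * (a + 2) ≤ K) (hε0 : 0 ≤ ε)
    (hε : ε * ((K : ℝ) + a + 1) ≤ 1 / (4 * ((a + (r + g + 1) : ℕ) : ℝ))) (c : ℕ) (C : ℝ) :
    ∃ (p X G : ℕ) (q : ℕ × ℕ → ℕ), p.Prime ∧ X ≤ p ∧ 0 < G ∧
      IntersectionCondition (a + r) c q (confFlats a r g p X G) ∧
      C * incidenceBound 2 (a + r) (a + (r + g + 1)) ε (confPoints a (r + g) p X).card
        (confFlats a r g p X G).card (Function.update q (a, a + 1) 1) <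
          (incidences (confPoints a (r + g) p X) (confFlats a r g p X G) : ℝ) := by
  set d := a + (r + g + 1) with hd
  set b : ℕ := 4 ^ d * ((g + 1) * branching d c) with hb
  set c₁ : ℝ := 2 * (a + 1) + 4 + b * (2 ^ g * 4) with hc₁
  obtain ⟨c', hc', hbound⟩ := exists_incidenceBound_le ha hr (c := c₁) hK hε0 (by positivity) hε
  rw [← hd] at hbound
  set δ : ℝ := 1 / (4 * (d : ℝ)) with hδ
  have hd0 : (0 : ℝ) < d := by exact_mod_cast (by omega : 0 < d)
  have hδ0 : 0 < δ := by positivity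
  -- The constants c' and C are fixed before X, so the power saving X^δ beats them.
  obtain ⟨X, hX1, hXC⟩ : ∃ X : ℕ, 1 ≤ X ∧ |C| * c' < (X : ℝ) ^ δ := by
    have h := (tendsto_rpow_atTop hδ0).comp (tendsto_natCast_atTop_atTop (R := ℝ))
    obtain ⟨X, h1, h2⟩ := ((Filter.eventually_ge_atTop 1).and
      (h.eventually_gt_atTop (|C| * c'))).exists
    exact ⟨X, h1, h2⟩
  have hK1 : 1 ≤ K := le_trans (Nat.succ_le_of_lt (by positivity)) hK
  have hXr : (1 : ℝ) ≤ X := by exact_mod_cast hX1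
  have hX0 : (0 : ℝ) < X := by linarith
  -- Bertrand's postulate gives X^K < p ≤ 2X^K.
  obtain ⟨p, hp, hp1, hp2⟩ := Nat.exists_prime_lt_and_le_two_mul (X ^ K) (by positivity)
  have hp0 : 0 < p := hp.pos
  have hXp : X ≤ p := (Nat.le_self_pow (by omega) X).trans hp1.le
  have hn0 : 0 < p * (p * X) := by positivity
  obtain ⟨G, hG, hGr⟩ := exists_pow_ge_le_rpow hn0 g
  have hG0 : 0 < G := by
    rcases Nat.eq_zero_or_pos G with rfl | h
    · simp at hG
      omega
    · exact h
  have hp1r : (X : ℝ) ^ K ≤ p := by exact_mod_cast hp1.le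
  have hp2r : (p : ℝ) ≤ 2 * (X : ℝ) ^ K := by exact_mod_cast hp2
  set ν : ℝ := 2 * K + 1 with hν
  have hν0 : 0 ≤ ν := by positivity
  have hpowν : (X : ℝ) ^ ν = X ^ K * (X ^ K * X) := by
    have : ν = ((2 * K + 1 : ℕ) : ℝ) := by rw [hν]; push_cast; ring
    rw [this, Real.rpow_natCast]
    ring
  have hnub : ((p * (p * X) : ℕ) : ℝ) ≤ 4 * (X : ℝ) ^ ν := by
    rw [hpowν]
    push_cast
    calc (p : ℝ) * (p * X) ≤ (2 * (X : ℝ) ^ K) * ((2 * (X : ℝ) ^ K) * X) := by gcongr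
      _ = _ := by ring
  have hb0 : (0 : ℝ) ≤ b * (2 ^ g * 4) := by positivity
  have hQub : ((b * G ^ g : ℕ) : ℝ) ≤ b * (2 ^ g * 4) * (X : ℝ) ^ (ν - ν / (g + 1)) := by
    rw [Nat.cast_mul, mul_assoc]
    refine mul_le_mul_of_nonneg_left (hGr.trans ?_) (by positivity)
    rw [mul_assoc]
    refine mul_le_mul_of_nonneg_left ?_ (by positivity)
    have hg : (0 : ℝ) < (g : ℝ) + 1 := by positivity
    refine (Real.rpow_le_rpow (by positivity) hnub (by positivity)).trans ?_
    rw [Real.mul_rpow (by norm_num) (by positivity), ← Real.rpow_mul hX0.le]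
    have e1 : ν * ((g : ℝ) / (g + 1)) = ν - ν / (g + 1) := by
      field_simp
      ring
    rw [e1]
    gcongr
    calc (4 : ℝ) ^ ((g : ℝ) / (g + 1)) ≤ 4 ^ (1 : ℝ) :=
          Real.rpow_le_rpow_of_exponent_le (by norm_num) (by
            rw [div_le_one hg]; linarith)
      _ = 4 := Real.rpow_one 4
  -- For k' ≤ a the trivial bound n; for larger k' the Hilbert function bound, whose constant b
  -- depends on c.
  set q : ℕ × ℕ → ℕ := fun x => if x.1 ≤ a then p * (p * X) else b * G ^ g with hq
  refine ⟨p, X, G, q, hp, hXp, hG0, ?_, ?_⟩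
  · refine intersectionCondition_conf ha hG q (fun x hx => ?_) fun x hx => ?_
    · simp [hq, hx]
    · simp only [hq, if_neg (not_le.2 hx), hb, hd]
      exact le_of_eq (by ring)
  have hm : ((confPoints a (r + g) p X).card : ℝ) ≤ c₁ * (X : ℝ) ^ ((K : ℝ) + a + 1) := by
    have e : (X : ℝ) ^ ((K : ℝ) + a + 1) = X ^ a * (X ^ K * X) := by
      have : (K : ℝ) + a + 1 = ((K + a + 1 : ℕ) : ℝ) := by push_cast; ring
      rw [this, Real.rpow_natCast]
      ring
    rw [card_confPoints, e]
    push_cast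
    calc (X : ℝ) ^ a * ((a + 1) * (p * X)) ≤ X ^ a * ((a + 1) * ((2 * (X : ℝ) ^ K) * X)) := by
          gcongr
      _ = (2 * (a + 1)) * (X ^ a * (X ^ K * X)) := by ring
      _ ≤ _ := by
        gcongr
        linarith
  have hn : ((confFlats a r g p X G).card : ℝ) ≤ c₁ * (X : ℝ) ^ ν := by
    rw [card_confFlats ha]
    refine hnub.trans ?_
    gcongr
    have : (0 : ℝ) ≤ 2 * (a + 1) := by positivity
    linarith
  have hqub : ∀ x, ((Function.update q (a, a + 1) 1 x : ℕ) : ℝ) ≤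
      c₁ * (X : ℝ) ^ confExponent a g ν x := by
    intro x
    have ha0 : (0 : ℝ) ≤ 2 * (a + 1) := by positivity
    have hν1 : 0 ≤ ν - ν / ((g : ℝ) + 1) := by
      have : ν / ((g : ℝ) + 1) ≤ ν := div_le_self hν0 (by linarith [(Nat.cast_nonneg g : (0:ℝ) ≤ g)])
      linarith
    by_cases hx : x = (a, a + 1)
    · rw [hx, Function.update_self, confExponent, if_neg (by simp)]
      have := Real.one_le_rpow hXr hν1
      push_cast
      nlinarith
    · rw [Function.update_of_ne hx]
      by_cases hxa : x.1 ≤ a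
      · rw [confExponent, if_pos ⟨hxa, hx⟩]
        simp only [hq, if_pos hxa]
        refine hnub.trans ?_
        gcongr
        linarith
      · rw [confExponent, if_neg fun h => hxa h.1]
        simp only [hq, if_neg hxa]
        refine hQub.trans ?_
        gcongr
        linarith
  have hB := hbound X _ _ _ hXr hm hn hqub
  have hI : (X : ℝ) ^ (2 * (K : ℝ) + a + 1) ≤
      (incidences (confPoints a (r + g) p X) (confFlats a r g p X G) : ℝ) := by
    have h1 : ((p * (p * X) * X ^ a : ℕ) : ℝ) ≤ _ :=
      Nat.cast_le.2 (incidences_conf_ge (r := r) (g := g) (X := X) (G := G) ha hp0)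
    refine le_trans ?_ h1
    have : 2 * (K : ℝ) + a + 1 = ((2 * K + a + 1 : ℕ) : ℝ) := by push_cast; ring
    rw [this, Real.rpow_natCast]
    push_cast
    calc (X : ℝ) ^ (2 * K + a + 1) = (X ^ K * (X ^ K * X)) * X ^ a := by ring
      _ ≤ _ := by gcongr
  refine lt_of_lt_of_le ?_ hI
  have hsplit : (X : ℝ) ^ (2 * (K : ℝ) + a + 1) =
      X ^ δ * X ^ (2 * (K : ℝ) + a + 1 - δ) := by
    rw [← Real.rpow_add hX0]
    congr 1
    ring
  rw [hsplit]
  calc _ ≤ |C| * _ := mul_le_mul_of_nonneg_right (le_abs_self C) (incidenceBound_nonneg ..)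
    _ ≤ |C| * (c' * X ^ (2 * (K : ℝ) + a + 1 - δ)) :=
      mul_le_mul_of_nonneg_left hB (abs_nonneg C)
    _ = |C| * c' * X ^ (2 * (K : ℝ) + a + 1 - δ) := by ring
    _ < _ := mul_lt_mul_of_pos_right hXC (by positivity)

end FlatIncidence

end

open FlatIncidence in
/-- In the incidence bound for `k`-flats in `ℝ^d` and `s = 2`, the parameter `q_{d'-1,d'}` is
replaced by `1` in every term; the bound so obtained fails. For some `t` and all small `ε`, no choice
of the constants `c` and `C` makes it valid: there are `m` points in a `d'`-flat `F`, and `n`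
`k`-flats meeting `F` in `(d'-1)`-flats, that satisfy all hypotheses of the incidence bound and
violate it. -/
theorem theorem1p4 (k d d' : ℕ) (hk : 0 < k) (hd : 0 < d) (hd' : 0 < d')
    (hratio : (k : ℝ) / d < ((d' : ℝ) - 1) / d') (hle : d' - 1 ≤ k) :
    ∃ t : ℕ, 0 < t ∧ ∃ ε₀ : ℝ, 0 < ε₀ ∧ ∀ ε : ℝ, 0 < ε → ε ≤ ε₀ → ∀ (c : ℕ) (C : ℝ),
      ∃ (P : Finset (Fin d → ℝ)) (V : Finset (AffineSubspace ℝ (Fin d → ℝ)))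
        (q : ℕ × ℕ → ℕ) (F : AffineSubspace ℝ (Fin d → ℝ)),
        (∀ v ∈ V, IsFlat k v) ∧
        NoBiclique 2 t P V ∧
        IntersectionCondition k c q V ∧
        IsFlat d' F ∧ (∀ p ∈ P, p ∈ F) ∧ (∀ v ∈ V, IsFlat (d' - 1) (v ⊓ F)) ∧
        C * incidenceBound 2 k d ε P.card V.card (Function.update q (d' - 1, d') 1) <
          (incidences P V : ℝ) := by
  obtain ⟨a, r, g, ha, hr, rfl, rfl, rfl⟩ := exists_dims_of_ratio_lt hd hd' hratio hle
  set K : ℕ := (a + (r + g + 1)) ^ 3 * (g + 1) * (a + 2) with hK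
  have hK0 : (0 : ℝ) < (K : ℝ) + a + 1 := by positivity
  have hd0 : (0 : ℝ) < ((a + (r + g + 1) : ℕ) : ℝ) := by exact_mod_cast hd
  refine ⟨a + 1, by omega, 1 / (4 * ((a + (r + g + 1) : ℕ) : ℝ)) / ((K : ℝ) + a + 1),
    by positivity, fun ε hε0 hε c C => ?_⟩
  obtain ⟨p, X, G, q, hp, hXp, hG, hI, hlt⟩ := exists_configuration ha hr hK.ge hε0.le
    ((le_div_iff₀ hK0).1 hε) c C
  have := Fact.mk hp
  classical
  refine ⟨confPoints a (r + g) p X, confFlats a r g p X G, q, frameFlat a (r + g), ?_,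
    noBiclique_conf hXp, hI, isFlat_frameFlat a (r + g), ?_, ?_, hlt⟩
  · intro v hv
    obtain ⟨i, -, rfl⟩ := Finset.mem_image.1 hv
    exact isFlat_flatOf _ _ _ _ (fiber_labels_injective hG)
  · intro x hx
    obtain ⟨y, -, rfl⟩ := Finset.mem_image.1 hx
    exact framePoint_mem_frameFlat ..
  · intro v hv
    obtain ⟨i, -, rfl⟩ := Finset.mem_image.1 hv
    exact isFlat_flatOf_inf_frameFlat ..
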